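/- **Network.** Nodes are $\Omega=\{0,1,\dots,N\}$, with $0$ the destination. Time is slotted. For each $i\in\Omega$, $P(\cdot|i)$ is a probability distribution on the subsets $S\subseteq\Omega$ (the set of nodes receiving a packet transmitted by $i$), with $i\in S$ whenever $P(S|i)>0$. Write $i\to j$ if $j\in S$ for some $S$ with $P(S|i)>0$; the network is assumed connected, i.e. every node has a path $i\to j_1\to\dots\to j_l\to 0$. Let $p_{\min}=\min\{P(S|i): P(S|i)>0\}$. **Dynamics.** The pairs (arrival vector $A(t)\in\mathbb N^N$, receptions $(S_i(t))_{i\in\Omega}$) are i.i.d. over time, $A$ is bounded, $S_i(t)$ has law $P(\cdot|i)$, and $\lambda_i=\mathbb E[A_i(t)]$. A routing policy chooses, as a function of $Q(s),S(s),\mu(s)$ $(s<t)$ and $Q(t),S(t)$, decisions $\mu_{ij}(t)\in\{0,1\}$ with $\mu_{ij}(t)\le \mathbf 1_{\{j\in S_i(t)\}}$, $\sum_j\mu_{ij}(t)\le1$, and $\mu_{i0}(t)=1$ if $0\in S_i(t)$. Queues start at any $Q(0)\in\mathbb N^N$, $Q_0\equiv 0$, and for $i\ne 0$ $$Q_i(t+1)=\Big[Q_i(t)-\sum_j\mu_{ij}(t)\Big]^++\sum_j\mu_{ji}(t)\mathbf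 1_{\{Q_j(t)\ge\mu_{ji}(t)\}}+A_i(t).$$ A policy stabilizes the network if $\limsup_T \frac1T\sum_{t<T}\mathbb E[Q_i(t)]<\infty$ for every $i$ and every $Q(0)$. The stability region is the set of rate vectors $\lambda\in\mathbb R^N$ for which some such traffic with rates $\lambda$ is stabilized by some policy. A policy is throughput optimal if it stabilizes the network under every such traffic whose rate vector lies in the interior of the stability region. **Rankings.** A rank ordering $R=(C_1,\dots,C_M)$ is an ordered partition of $\{1,\dots,N\}$ into non-empty classes; $a\prec^R b$ if $a$ is in an earlier class than $b$, and $0$ precedes every other node. Put $C^i=C_1\cup\dots\cup C_i$ and $Q_C=\sum_{k\in C}Q_k$. $R'$ refines $R$ if $a\prec^R b$ implies $a\prec^{R'}b$. A one-step refinement splits one class $C_i$ into two consecutive non-empty classes; its inverse is a one-step confinement; both kinds are called adjacent. $R$ is path-connected if every node $i\neq0$ has a path to $0$ through distinct nodes $j_n\preceq^R i$. A policy is priority-based with rankings $R(t)$ if every node $i$ selects exactly one node of lowest rank in $S_i(t)$ according to $R(t)$. It respects another priority-based policy with rankings $R(t)$ if its rankings $R'(t)$ refine $R(t)$ always (for the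 same past and current backlog). For $f:\mathbb N\times\mathbb N\to\mathbb R$, with $f(m,n)>0$ for $n>0$, let $\Lambda_f(Q,R,n)=\sum_{i=1}^n f(|C^{i-1}|,|C_i|)\,Q_{C_i}$. For adjacent $R,R'$, with $m$ the first index at which their classes differ, write $R<_QR'$ if $\Lambda_f(Q,R,m)<\Lambda_f(Q,R',m)$, or if these are equal and $R$ is a one-step confinement of $R'$. Say $R=\pi^c_f(Q)$ if $R$ is path-connected and $R<_QR'$ for every path-connected $R'$ adjacent to $R$. A path-connected $f$-policy is a priority-based policy with rankings $R(t)=\pi^c_f(Q(t))$. **ORCD.** For $Q\in\mathbb R^N_+$ let $V=V(Q)$ be the largest solution of $$V_0=0,\qquad V_i=Q_i+\sum_{S\subseteq\Omega}P(S|i)\min_{j\in S}V_j\quad(i\neq 0).$$ An ORCD ranking for $Q$ is any rank ordering in which $V_i<V_j$ implies $i\prec j$; an ORCD policy is a priority-based policy whose ranking $R(t)$ is always an ORCD ranking for $Q(t)$. **Theorem.** 1. For every $Q\in\mathbb R^N_+$ the largest solution $V(Q)$ exists; if all $Q_i>0$, it is the only solution. 2. Let $f$ satisfy $f(m,n)>0$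 for $n>0$ and, for all $m\ge0$ and $n_1,n_2>0$, $$\text{(C1)}\quad \frac1{f(m,n_1+n_2)}=\frac1{f(m,n_1)}+\frac1{f(m+n_1,n_2)},\qquad\qquad \frac{f(m,n_1)}{f(m+n_1,n_2)}\ge\frac1{p_{\min}}.$$ Then for every $Q\in\mathbb R^N_+$ there is exactly one $R=\pi^c_f(Q)$, and every ORCD ranking for $Q$ refines it. Hence every ORCD policy respects every path-connected $f$-policy. 3. ORCD policies exist, and every ORCD policy is throughput optimal. -/

import Mathlib

open scoped ENNReal

namespace Routing

/-- The nodes `0, 1, …, N`: `none` is the destination `0`, `some i` are the other `N` nodes. -/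
abbrev Node (N : ℕ) := Option (Fin N)

/-- Numbers of packets queued at the nodes other than the destination. -/
abbrev Backlog (N : ℕ) := Fin N → ℕ

/-- For every node `i`, the set `S_i` of nodes that received the packet transmitted by `i`. -/
abbrev Reception (N : ℕ) := Node N → Finset (Node N)

/-- The matrix `μ_{ij}` of packets shifted from `i` to `j` during one slot. -/
abbrev Decision (N : ℕ) := Node N → Node N → ℕ

/-! ### The network -/

/-- The local broadcast model: `P i` is the law `S ↦ P(S|i)` of the set of receivers of a packet
transmitted by `i`; the transmitter always belongs to it. -/
structure Network (N : ℕ) where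
  P : Node N → PMF (Finset (Node N))
  self_mem : ∀ i, ∀ S ∈ (P i).support, i ∈ S

namespace Network

variable {N : ℕ} (net : Network N)

/-- The real number `P(S|i)`. -/
noncomputable def prob (i : Node N) (S : Finset (Node N)) : ℝ := (net.P i S).toReal

/-- `i → j`. -/
def Reaches (i j : Node N) : Prop := ∃ S : Finset (Node N), j ∈ S ∧ 0 < net.prob i S

/-- `i → j₁ → ⋯ → j_l → 0` for the list `j₁, …, j_l` (possibly empty). -/
def IsPathToDest (i : Fin N) (l : List (Fin N)) : Prop :=
  List.IsChain net.Reaches ((i :: l).map some ++ [none])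

/-- Every node has a path to the destination. -/
def Connected : Prop := ∀ i : Fin N, ∃ l : List (Fin N), net.IsPathToDest i l

/-- The smallest positive reception probability (the infimum is over a finite non-empty set). -/
noncomputable def pMin : ℝ := sInf {p : ℝ | 0 < p ∧ ∃ i S, p = net.prob i S}

end Network

/-! ### Routing policies and queue dynamics -/

/-- The constraints on the routing decisions of one slot, given the receptions `S`. -/
structure IsRoutingDecision {N : ℕ} (S : Reception N) (μ : Decision N) : Prop where
  le_indicator : ∀ i j, μ i j ≤ if j ∈ S i then 1 else 0
  sum_le_one : ∀ i, ∑ j, μ i j ≤ 1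
  dest : ∀ i, none ∈ S i → μ i none = 1

/-- What is recorded about one elapsed slot. -/
structure Slot (N : ℕ) where
  backlog : Backlog N
  reception : Reception N
  decision : Decision N

/-- A routing policy: the decisions of slot `t` are a function of the past
`Q(s), S(s), μ(s)`, `s < t` (a list of length `t`, most recent slot first), and of the current
`Q(t)` and `S(t)`. -/
structure RoutingPolicy (N : ℕ) where
  decide : List (Slot N) → Backlog N → Reception N → Decision N
  valid : ∀ H Q S, IsRoutingDecision S (decide H Q S)

/-- The backlog of a node; the destination has none. -/
def nodeBacklog {N : ℕ} (Q : Backlog N) : Node N → ℕ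
  | none => 0
  | some i => Q i

/-- The queue recursion
`Q_i(t+1) = [Q_i(t) - ∑_j μ_{ij}]⁺ + ∑_j μ_{ji} 1{Q_j(t) ≥ μ_{ji}} + A_i(t)`
(the subtraction of natural numbers is the positive part of the difference). -/
def nextBacklog {N : ℕ} (Q : Backlog N) (μ : Decision N) (A : Fin N → ℕ) : Backlog N := fun i =>
  (Q i - ∑ j, μ (some i) j)
    + (∑ j, if μ j (some i) ≤ nodeBacklog Q j then μ j (some i) else 0) + A i

/-- The joint law of the arrivals `A(t)` and the receptions `S(t)` of one slot: `S_i(t)` has law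
`P(·|i)` and the arrivals are bounded. No independence inside a slot is required. -/
structure Traffic {N : ℕ} (net : Network N) where
  law : PMF ((Fin N → ℕ) × Reception N)
  map_reception : ∀ i, law.map (fun o => o.2 i) = net.P i
  bounded : ∃ Amax : ℕ, ∀ o ∈ law.support, ∀ i, o.1 i ≤ Amax

/-- Expectation of a natural-number-valued function of a discrete random element. -/
noncomputable def expect {α : Type} (p : PMF α) (g : α → ℕ) : ℝ≥0∞ := ∑' a, p a * (g a : ℝ≥0∞)

section Stability

variable {N : ℕ} {net : Network N}

/-- The arrival rates `λ_i = E[A_i(t)]`. -/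
noncomputable def Traffic.rate (tr : Traffic net) : Fin N → ℝ :=
  fun i => (expect tr.law (fun o => o.1 i)).toReal

/-- The law of (past up to `t`, `Q(t)`) when a policy is used from the initial backlog `q₀`; in
every slot a pair (arrivals, receptions) is drawn from `tr.law`, independently of the past. -/
noncomputable def stateLaw (tr : Traffic net) (pol : RoutingPolicy N) (q₀ : Backlog N) :
    ℕ → PMF (List (Slot N) × Backlog N)
  | 0 => PMF.pure ([], q₀)
  | t + 1 => (stateLaw tr pol q₀ t).bind fun x => tr.law.map fun o =>
      (⟨x.2, o.2, pol.decide x.1 x.2 o.2⟩ :: x.1,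
        nextBacklog x.2 (pol.decide x.1 x.2 o.2) o.1)

/-- `E[Q_i(t)]`. -/
noncomputable def meanBacklog (tr : Traffic net) (pol : RoutingPolicy N) (q₀ : Backlog N)
    (t : ℕ) (i : Fin N) : ℝ≥0∞ :=
  expect (stateLaw tr pol q₀ t) (fun x => x.2 i)

/-- The time average backlog of every node remains finite. -/
def Stabilizes (tr : Traffic net) (pol : RoutingPolicy N) : Prop :=
  ∀ (q₀ : Backlog N) (i : Fin N),
    Filter.limsup (fun T : ℕ => (∑ t ∈ Finset.range T, meanBacklog tr pol q₀ t i) / (T : ℝ≥0∞))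
      Filter.atTop < ⊤

variable (net) in
/-- The arrival rate vectors for which some routing policy stabilizes the network. -/
def stabilityRegion : Set (Fin N → ℝ) :=
  {lam | ∃ tr : Traffic net, tr.rate = lam ∧ ∃ pol : RoutingPolicy N, Stabilizes tr pol}

variable (net) in
/-- The policy stabilizes the network for all arrivals whose rate vector is interior to the
stability region. -/
def ThroughputOptimal (pol : RoutingPolicy N) : Prop :=
  ∀ lam ∈ interior (stabilityRegion net),
    ∀ tr : Traffic net, tr.rate = lam → Stabilizes tr pol

end Stability

/-! ### Rank orderings and priority-based policies -/

/-- A rank ordering `(C₁, …, C_M)` of the nodes other than the destination. -/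
structure RankOrdering (N : ℕ) where
  classes : List (Finset (Fin N))
  nonempty : ∀ C ∈ classes, C.Nonempty
  disjoint : classes.Pairwise Disjoint
  cover : ∀ i, ∃ C ∈ classes, i ∈ C

namespace RankOrdering

variable {N : ℕ}

/-- The index of the class of a node; the destination comes before all classes. -/
def rank (R : RankOrdering N) : Node N → ℕ
  | none => 0
  | some i => R.classes.findIdx (fun C => decide (i ∈ C)) + 1

/-- `a ≺ b` -/
def lt (R : RankOrdering N) (a b : Node N) : Prop := R.rank a < R.rank b

/-- `a ≼ b` -/
def le (R : RankOrdering N) (a b : Node N) : Prop := R.rank a ≤ R.rank b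

/-- `R'` is a refinement of `R`. -/
def IsRefinement (R' R : RankOrdering N) : Prop := ∀ a b : Node N, R.lt a b → R'.lt a b

/-- `R'` is a one-step refinement of `R` (and `R` a one-step confinement of `R'`). -/
def IsOneStepRefinement (R' R : RankOrdering N) : Prop :=
  ∃ (pre post : List (Finset (Fin N))) (A B : Finset (Fin N)),
    R.classes = pre ++ (A ∪ B) :: post ∧ R'.classes = pre ++ A :: B :: post

/-- `R' ∈ 𝒜(R)` -/
def Adjacent (R R' : RankOrdering N) : Prop :=
  R'.IsOneStepRefinement R ∨ R.IsOneStepRefinement R'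

/-- `cls k` is the class `C_{k+1}` (empty beyond the last class). -/
def cls (R : RankOrdering N) (k : ℕ) : Finset (Fin N) := R.classes.getD k ∅

/-- `below k` is `C^k = C₁ ∪ ⋯ ∪ C_k`. -/
def below (R : RankOrdering N) (k : ℕ) : Finset (Fin N) := (Finset.range k).biUnion R.cls

/-- The penalty `Λ_f(Q, R, n) = ∑_{i=1}^n f(|C^{i-1}|, |C_i|) Q_{C_i}`. -/
def penalty (R : RankOrdering N) (f : ℕ → ℕ → ℝ) (Q : Fin N → ℝ) (n : ℕ) : ℝ :=
  ∑ k ∈ Finset.range n, f (R.below k).card (R.cls k).card * ∑ i ∈ R.cls k, Q i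

/-- The (one-based) index of the first class in which two distinct rank orderings differ. -/
noncomputable def mismatch (R R' : RankOrdering N) : ℕ := sInf {k | R.cls k ≠ R'.cls k} + 1

/-- `R` penalizes `Q` less than `R'`. Of two adjacent orderings with equal penalties, the coarser
one is preferred. -/
def PenalizesLess (R : RankOrdering N) (f : ℕ → ℕ → ℝ) (Q : Fin N → ℝ) (R' : RankOrdering N) :
    Prop :=
  R.penalty f Q (R.mismatch R') < R'.penalty f Q (R.mismatch R') ∨
    (R.penalty f Q (R.mismatch R') = R'.penalty f Q (R.mismatch R') ∧
      R'.IsOneStepRefinement R)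

/-- Every node has a path to the destination through distinct nodes of lower or equal rank. -/
def PathConnected (R : RankOrdering N) (net : Network N) : Prop :=
  ∀ i : Fin N, ∃ l : List (Fin N), l.Nodup ∧ net.IsPathToDest i l ∧
    ∀ j ∈ l, R.le (some j) (some i)

/-- `Q ∈ D_f^c(R)` with `R ∈ 𝓡_c`, that is, `R = π_f^c(Q)`. -/
def IsPathConnectedFRanking (R : RankOrdering N) (net : Network N) (f : ℕ → ℕ → ℝ)
    (Q : Fin N → ℝ) : Prop :=
  R.PathConnected net ∧
    ∀ R' : RankOrdering N, R'.PathConnected net → R.Adjacent R' → R.PenalizesLess f Q R'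

end RankOrdering

/-- A choice of a rank ordering `R(t)` from the past and the current backlog. -/
abbrev RankProcess (N : ℕ) := List (Slot N) → Backlog N → RankOrdering N

/-- Under the policy `Π_{R(t)}`, every node `i` selects, among its potential forwarders `S_i(t)`
(which contain `i`), a node with the lowest rank according to `R(t)`. -/
def IsPriorityBased {N : ℕ} (pol : RoutingPolicy N) (R : RankProcess N) : Prop :=
  ∀ H Q S, (∀ i, i ∈ S i) → ∀ i, ∃ j ∈ S i,
    (∀ k ∈ S i, (R H Q).le j k) ∧ pol.decide H Q S i j = 1

/-- The policy with rankings `R'(t)` respects the one with rankings `R(t)`. -/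
def Respects {N : ℕ} (R' R : RankProcess N) : Prop := ∀ H Q, (R' H Q).IsRefinement (R H Q)

/-- A path-connected `f`-policy: `R(t) = π_f^c(Q(t))`. -/
def IsPathConnectedFPolicy {N : ℕ} (net : Network N) (f : ℕ → ℕ → ℝ) (pol : RoutingPolicy N)
    (R : RankProcess N) : Prop :=
  IsPriorityBased pol R ∧
    ∀ H Q, (R H Q).IsPathConnectedFRanking net f (fun i => (Q i : ℝ))

/-! ### ORCD -/

/-- `min_{j ∈ S} V_j`, with an irrelevant value for `S = ∅`, which is never received. -/
noncomputable def minOver {N : ℕ} (V : Node N → ℝ) (S : Finset (Node N)) : ℝ :=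
  if h : S.Nonempty then S.inf' h V else 0

/-- `V₀ = 0` and `V_i = Q_i + ∑_S P(S|i) min_{j ∈ S} V_j` for the other nodes. -/
def IsCostFixedPoint {N : ℕ} (net : Network N) (Q : Fin N → ℝ) (V : Node N → ℝ) : Prop :=
  V none = 0 ∧
    ∀ i : Fin N, V (some i) = Q i + ∑ S : Finset (Node N), net.prob (some i) S * minOver V S

/-- The congestion costs: the largest solution of the fixed point equation. (If some queue is
empty the equation may have further solutions, because `i ∈ S` whenever `P(S|i) > 0`.) -/
def IsCongestionCost {N : ℕ} (net : Network N) (Q : Fin N → ℝ) (V : Node N → ℝ) : Prop :=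
  IsGreatest {W | IsCostFixedPoint net Q W} V

/-- The nodes are ordered by congestion cost; ties may be broken or kept. -/
def IsORCDRanking {N : ℕ} (net : Network N) (Q : Fin N → ℝ) (R : RankOrdering N) : Prop :=
  ∃ V, IsCongestionCost net Q V ∧ ∀ i j : Node N, V i < V j → R.lt i j

/-- An ORCD policy. -/
def IsORCDPolicy {N : ℕ} (net : Network N) (pol : RoutingPolicy N) (R : RankProcess N) : Prop :=
  IsPriorityBased pol R ∧ ∀ H Q, IsORCDRanking net (fun i => (Q i : ℝ)) (R H Q)

/-! ### Conditions on the bivariate function -/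

/-- Condition (C1). -/
def CondC1 (f : ℕ → ℕ → ℝ) : Prop :=
  ∀ m n₁ n₂ : ℕ, 0 < n₁ → 0 < n₂ → 1 / f m (n₁ + n₂) = 1 / f m n₁ + 1 / f (m + n₁) n₂

/-- `f(m,n₁) / f(m+n₁,n₂) ≥ 1 / p_min`. -/
def CondRatio {N : ℕ} (net : Network N) (f : ℕ → ℕ → ℝ) : Prop :=
  ∀ m n₁ n₂ : ℕ, 0 < n₁ → 0 < n₂ → f m n₁ / f (m + n₁) n₂ ≥ 1 / net.pMin

end Routing

/-! ### Congestion costs, rooted sets, and when a set precedes its complement -/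

namespace Routing

open Finset

variable {N : ℕ}

/-! ### Reception probabilities -/

namespace Network

variable (net : Network N)

/-! Call a set `A` of nodes rooted if each of its nodes reaches 0 inside `A`. Rooted sets are closed
under union, but not under intersection. Two facts about the largest solution `V` carry everything.
On a rooted `A` the costs are at most `Q_A / p_min`, because a link out of `k` raises the cost by at
most `Q_k / p_min`. And the sublevel sets of `V` are rooted, since otherwise `V` could be raised on
a part of one and would not be largest. Hence, if `Q_k > Q_A / p_min` for every `k` that can be
added to `A` with the result still rooted, then all costs in `A` are strictly below all costs
outside (`IsCongestionCost.lt_of_marginal`).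

Respecting the `f`-policy: (C1) says that `1 / f(m,n) = φ(m+n) - φ(m)` for an increasing `φ`, so a
penalty term `f(|B|,|C|) Q_C` is the slope of the chord from `B` to `B ∪ C` in the plane of points
`(φ|A|, Q_A)`. An `f`-ranking is then exactly a chain of rooted sets forming a lower hull
(`isPathConnectedFRanking_iff`). The ratio condition makes the increments of `φ` grow by the factor
`1 / p_min`. Since this factor is at least 1, sets of least slope are closed under union, whence
existence and uniqueness of the hull; the full factor makes every prefix of the hull satisfy the
criterion above (`IsHull.congestionCost_lt`).

Throughput optimality: fix a geometric `φ`, and for each integer slope `s` let `L_s` be the largest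
rooted minimizer of `Q_A - s φ|A|`. The criterion applies to `L_s`, so ORCD sends every packet that
can leave the complement of `L_s` out of it and lets none in: for all `s` at once, the complement is
drained at the full rate of its cut. Summing the minimization problems over `s` gives a convex
Lyapunov function whose gradient counts the levels not containing a node. Stabilizable rates obey
every cut constraint, so interior rates leave slack in each cut, and the drift is negative and
linear in the backlog. -/

theorem prob_nonneg (i : Node N) (S : Finset (Node N)) : 0 ≤ net.prob i S :=
  ENNReal.toReal_nonneg

theorem sum_prob (i : Node N) : ∑ S, net.prob i S = 1 := by
  have h := (net.P i).tsum_coe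
  rw [tsum_fintype] at h
  unfold prob
  rw [← ENNReal.toReal_sum (fun S _ => (net.P i).apply_ne_top S), h, ENNReal.toReal_one]

theorem mem_of_prob_pos {i : Node N} {S : Finset (Node N)} (h : 0 < net.prob i S) : i ∈ S := by
  refine net.self_mem i S ?_
  rw [PMF.mem_support_iff]
  intro h0
  simp [prob, h0] at h

theorem exists_prob_pos (i : Node N) : ∃ S, 0 < net.prob i S := by
  by_contra! h
  have h1 := net.sum_prob i
  have : ∑ S, net.prob i S ≤ 0 := Finset.sum_nonpos fun S _ => h S
  linarith

theorem finite_probs : {p : ℝ | 0 < p ∧ ∃ i S, p = net.prob i S}.Finite := by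
  refine (Set.finite_range fun x : Node N × Finset (Node N) => net.prob x.1 x.2).subset ?_
  rintro p ⟨-, i, S, rfl⟩
  exact ⟨(i, S), rfl⟩

theorem pMin_pos : 0 < net.pMin := by
  obtain ⟨S, hS⟩ := net.exists_prob_pos none
  have hne : {p : ℝ | 0 < p ∧ ∃ i S, p = net.prob i S}.Nonempty := ⟨_, hS, none, S, rfl⟩
  exact (hne.csInf_mem net.finite_probs).1

theorem pMin_le {i : Node N} {S : Finset (Node N)} (h : 0 < net.prob i S) :
    net.pMin ≤ net.prob i S :=
  csInf_le net.finite_probs.bddBelow ⟨h, i, S, rfl⟩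

theorem pMin_le_one : net.pMin ≤ 1 := by
  obtain ⟨S, hS⟩ := net.exists_prob_pos none
  refine (net.pMin_le hS).trans ?_
  rw [← net.sum_prob none]
  exact Finset.single_le_sum (fun T _ => net.prob_nonneg none T) (Finset.mem_univ S)

/-! ### Rooted sets of nodes -/

/-- `k` can reach the destination or a node of `A` in one hop. -/
def Links (A : Finset (Fin N)) (k : Fin N) : Prop :=
  ∃ j ∈ insertNone A, net.Reaches (some k) j

/-- Every node of `A` has a path to the destination inside `A`. -/
def Rooted (A : Finset (Fin N)) : Prop :=
  ∀ W ⊆ A, W.Nonempty → ∃ k ∈ W, net.Links (A \ W) k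

variable {net}

theorem Links.mono {A B : Finset (Fin N)} {k : Fin N} (h : net.Links A k) (hAB : A ⊆ B) :
    net.Links B k := by
  obtain ⟨j, hj, hr⟩ := h
  exact ⟨j, insertNone.monotone hAB hj, hr⟩

theorem rooted_empty : net.Rooted ∅ := by
  intro W hW hne
  rw [subset_empty.1 hW] at hne
  exact absurd hne Finset.not_nonempty_empty

/-- The cut form of rootedness makes this immediate: if `W` meets `A`, then the exit of `W ∩ A`
inside `A` lands in `A \ W`, so it is an exit of `W` as well. -/
theorem Rooted.union {A B : Finset (Fin N)} (hA : net.Rooted A) (hB : net.Rooted B) :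
    net.Rooted (A ∪ B) := by
  have key : ∀ {A' : Finset (Fin N)}, net.Rooted A' → A' ⊆ A ∪ B → ∀ W : Finset (Fin N),
      (W ∩ A').Nonempty → ∃ k ∈ W, net.Links ((A ∪ B) \ W) k := by
    intro A' hA' hsub W hne
    obtain ⟨k, hk, hl⟩ := hA' (W ∩ A') inter_subset_right hne
    refine ⟨k, (mem_inter.1 hk).1, hl.mono ?_⟩
    intro x hx
    simp only [mem_sdiff, mem_inter, not_and] at hx ⊢
    exact ⟨hsub hx.1, fun h => hx.2 h hx.1⟩
  intro W hW hne
  obtain ⟨x, hx⟩ := hne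
  rcases mem_union.1 (hW hx) with h | h
  · exact key hA subset_union_left W ⟨x, mem_inter.2 ⟨hx, h⟩⟩
  · exact key hB subset_union_right W ⟨x, mem_inter.2 ⟨hx, h⟩⟩

theorem Rooted.insert {A : Finset (Fin N)} (hA : net.Rooted A) {k : Fin N}
    (hk : net.Links A k) : net.Rooted (Insert.insert k A) := by
  intro W hW hne
  by_cases hWA : (W ∩ A).Nonempty
  · obtain ⟨k', hk', hl⟩ := hA (W ∩ A) inter_subset_right hWA
    refine ⟨k', (mem_inter.1 hk').1, hl.mono ?_⟩
    intro x hx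
    simp only [mem_sdiff, mem_inter, not_and] at hx ⊢
    exact ⟨mem_insert_of_mem hx.1, fun h => hx.2 h hx.1⟩
  · rw [not_nonempty_iff_eq_empty] at hWA
    have hd : ∀ x ∈ W, x ∉ A := fun x hx hxA => by
      have : x ∈ W ∩ A := mem_inter.2 ⟨hx, hxA⟩
      rw [hWA] at this
      exact absurd this (notMem_empty x)
    obtain ⟨x, hx⟩ := hne
    have hxk : x = k := (mem_insert.1 (hW hx)).resolve_right (hd x hx)
    subst hxk
    refine ⟨x, hx, hk.mono fun a ha => mem_sdiff.2 ⟨mem_insert_of_mem ha, fun h => hd a h ha⟩⟩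

/-- A rooted set can be built one linked node at a time: for a largest subset `B` with `p B`, the
cut condition for `A \ B` supplies the next node. -/
theorem Rooted.induction {A : Finset (Fin N)} (hA : net.Rooted A) {p : Finset (Fin N) → Prop}
    (empty : p ∅)
    (insert : ∀ B ⊆ A, p B → ∀ k ∈ A, k ∉ B → net.Links B k → p (Insert.insert k B)) : p A := by
  classical
  obtain ⟨B, hB, hmax⟩ := Finset.exists_max_image (A.powerset.filter p) Finset.card
    ⟨∅, by simp [empty]⟩
  simp only [mem_filter, mem_powerset] at hB hmax
  by_cases hBA : B = A
  · exact hBA ▸ hB.2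
  · have hne : (A \ B).Nonempty := by
      rw [sdiff_nonempty]
      exact fun h => hBA (hB.1.antisymm h)
    obtain ⟨k, hk, hl⟩ := hA (A \ B) sdiff_subset hne
    rw [mem_sdiff] at hk
    rw [sdiff_sdiff_right_self, inf_eq_inter, inter_eq_right.2 hB.1] at hl
    have := hmax (Insert.insert k B)
      ⟨insert_subset hk.1 hB.1, insert B hB.1 hB.2 k hk.1 hk.2 hl⟩
    rw [card_insert_of_notMem hk.2] at this
    omega

/-- A path to the destination that stays in `A` leaves every `W` that contains its start. -/
theorem exists_links_of_path {A W : Finset (Fin N)} :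
    ∀ (l : List (Fin N)) (i : Fin N), i ∈ W → net.IsPathToDest i l → (∀ j ∈ l, j ∈ A) →
      ∃ k ∈ W, net.Links (A \ W) k := by
  intro l
  induction l with
  | nil =>
    intro i hi hp _
    have : net.Reaches (some i) none := by simpa [IsPathToDest] using hp
    exact ⟨i, hi, none, by simp, this⟩
  | cons j l ih =>
    intro i hi hp hA
    have hp' : net.Reaches (some i) (some j) ∧ net.IsPathToDest j l := by
      simpa [IsPathToDest] using hp
    by_cases hj : j ∈ W
    · exact ih j hj hp'.2 fun x hx => hA x (List.mem_cons_of_mem _ hx)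
    · exact ⟨i, hi, some j, by simp [hj, hA j List.mem_cons_self], hp'.1⟩

theorem Connected.rooted_univ (h : net.Connected) : net.Rooted univ := by
  rintro W - ⟨i, hi⟩
  obtain ⟨l, hl⟩ := h i
  exact exists_links_of_path l i hi hl fun j _ => mem_univ j

/-- A rooted set contains simple paths to the destination. -/
theorem Rooted.exists_path {A : Finset (Fin N)} (hA : net.Rooted A) :
    ∀ i ∈ A, ∃ l : List (Fin N), (i :: l).Nodup ∧ net.IsPathToDest i l ∧ ∀ j ∈ l, j ∈ A := by
  refine hA.induction (p := fun B => ∀ i ∈ B, ∃ l : List (Fin N),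
    (i :: l).Nodup ∧ net.IsPathToDest i l ∧ ∀ j ∈ l, j ∈ B) (by simp) ?_
  intro B _ ih k _ hkB hl i hi
  rcases mem_insert.1 hi with rfl | hi
  · obtain ⟨j, hj, hr⟩ := hl
    cases j with
    | none => exact ⟨[], by simp, by simpa [IsPathToDest] using hr, by simp⟩
    | some j =>
      rw [some_mem_insertNone] at hj
      obtain ⟨l, hn, hp, hB⟩ := ih j hj
      refine ⟨j :: l, ?_, ?_, ?_⟩
      · rw [List.nodup_cons]
        refine ⟨fun hm => hkB ?_, hn⟩
        rcases List.mem_cons.1 hm with rfl | hm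
        · exact hj
        · exact hB _ hm
      · have : net.Reaches (some i) (some j) ∧ net.IsPathToDest j l := ⟨hr, hp⟩
        simpa [IsPathToDest] using this
      · intro x hx
        rcases List.mem_cons.1 hx with rfl | hx
        · exact mem_insert_of_mem hj
        · exact mem_insert_of_mem (hB x hx)
  · obtain ⟨l, hn, hp, hB⟩ := ih i hi
    exact ⟨l, hn, hp, fun j hj => mem_insert_of_mem (hB j hj)⟩

end Network

/-! ### The fixed point equation -/

theorem minOver_le (V : Node N → ℝ) {S : Finset (Node N)} {j : Node N} (hj : j ∈ S) :
    minOver V S ≤ V j := by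
  rw [minOver, dif_pos ⟨j, hj⟩]
  exact Finset.inf'_le _ hj

theorem le_minOver {V : Node N → ℝ} {S : Finset (Node N)} (hS : S.Nonempty) {c : ℝ}
    (h : ∀ j ∈ S, c ≤ V j) : c ≤ minOver V S := by
  rw [minOver, dif_pos hS]
  exact Finset.le_inf' _ _ h

theorem exists_minOver_eq (V : Node N → ℝ) {S : Finset (Node N)} (hS : S.Nonempty) :
    ∃ j ∈ S, minOver V S = V j := by
  rw [minOver, dif_pos hS]
  exact Finset.exists_mem_eq_inf' hS V

/-- The right-hand side of the fixed point equation. -/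
noncomputable def costMap (net : Network N) (Q : Fin N → ℝ) (V : Node N → ℝ) (i : Fin N) : ℝ :=
  Q i + ∑ S : Finset (Node N), net.prob (some i) S * minOver V S

/-- `V` satisfies the fixed point equation with `≤` in place of `=`. -/
def IsCostSubsolution (net : Network N) (Q : Fin N → ℝ) (V : Node N → ℝ) : Prop :=
  V none = 0 ∧ ∀ i : Fin N, V (some i) ≤ costMap net Q V i

variable {net : Network N} {Q : Fin N → ℝ} {V W : Node N → ℝ}

theorem IsCostFixedPoint.isCostSubsolution (h : IsCostFixedPoint net Q V) :
    IsCostSubsolution net Q V :=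
  ⟨h.1, fun i => (h.2 i).le⟩

theorem prob_mul_le (i : Node N) (S : Finset (Node N)) {a b : ℝ} (h : i ∈ S → a ≤ b) :
    net.prob i S * a ≤ net.prob i S * b := by
  rcases (net.prob_nonneg i S).eq_or_lt with h0 | h0
  · simp [← h0]
  · exact mul_le_mul_of_nonneg_left (h (net.mem_of_prob_pos h0)) h0.le

theorem sum_prob_mul_const (i : Node N) (c : ℝ) : ∑ S, net.prob i S * c = c := by
  rw [← Finset.sum_mul, net.sum_prob, one_mul]

theorem costMap_mono (hVW : V ≤ W) (i : Fin N) : costMap net Q V i ≤ costMap net Q W i := by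
  refine add_le_add le_rfl (Finset.sum_le_sum fun S _ => ?_)
  refine prob_mul_le _ _ fun hi => le_minOver ⟨_, hi⟩ fun j hj => ?_
  exact (minOver_le V hj).trans (hVW j)

/-- Since `i` itself belongs to every possible `S`, each minimum is at most `W i`; on one set `S₀`
containing `j` it is at most `W j`. So `P(S₀|i) (W i - W j) ≤ Q i`, and `P(S₀|i) ≥ p_min`. -/
theorem IsCostSubsolution.le_of_reaches (hQ : ∀ i, 0 ≤ Q i) (hW : IsCostSubsolution net Q W)
    {i : Fin N} {j : Node N} (h : net.Reaches (some i) j) :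
    W (some i) ≤ W j + Q i / net.pMin := by
  obtain ⟨S₀, hj, hpos⟩ := h
  have hp := net.pMin_pos
  by_contra! hlt
  have hq : 0 ≤ Q i / net.pMin := div_nonneg (hQ i) hp.le
  have h1 : ∑ S, net.prob (some i) S * minOver W S ≤
      ∑ S, (net.prob (some i) S * W (some i) +
        if S = S₀ then net.prob (some i) S₀ * (W j - W (some i)) else 0) := by
    refine Finset.sum_le_sum fun S _ => ?_
    split_ifs with hS
    · subst hS
      rw [← mul_add]
      exact prob_mul_le _ _ fun _ => by linarith [minOver_le W hj]
    · rw [add_zero]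
      exact prob_mul_le _ _ fun hi => minOver_le W hi
  rw [Finset.sum_add_distrib, sum_prob_mul_const] at h1
  simp only [Finset.sum_ite_eq', mem_univ, if_true] at h1
  have h2 := hW.2 i
  unfold costMap at h2
  have h3 : net.pMin * (W (some i) - W j) ≤ net.prob (some i) S₀ * (W (some i) - W j) :=
    mul_le_mul_of_nonneg_right (net.pMin_le hpos) (by linarith)
  have h4 : Q i < (W (some i) - W j) * net.pMin := by
    rw [← div_lt_iff₀ hp]; linarith
  nlinarith

theorem IsCostSubsolution.le_of_rooted (hQ : ∀ i, 0 ≤ Q i) (hW : IsCostSubsolution net Q W)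
    {A : Finset (Fin N)} (hA : net.Rooted A) :
    ∀ a ∈ insertNone A, W a ≤ (∑ i ∈ A, Q i) / net.pMin := by
  have hp := net.pMin_pos
  refine hA.induction (p := fun B => ∀ a ∈ insertNone B, W a ≤ (∑ i ∈ B, Q i) / net.pMin) ?_ ?_
  · intro a ha
    cases a with
    | none => simp [hW.1]
    | some a => simp at ha
  · intro B _ ih k _ hk hl a ha
    rw [Finset.sum_insert hk, add_div]
    have hq : 0 ≤ Q k / net.pMin := div_nonneg (hQ k) hp.le
    by_cases hak : a = some k
    · subst hak
      obtain ⟨j, hj, hr⟩ := hl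
      linarith [hW.le_of_reaches hQ hr, ih j hj]
    · have : a ∈ insertNone B := by
        cases a with
        | none => simp
        | some a =>
          simp only [some_mem_insertNone, mem_insert] at ha ⊢
          exact ha.resolve_left fun h => hak (by rw [h])
      linarith [ih a this]

theorem isCostSubsolution_zero (hQ : ∀ i, 0 ≤ Q i) : IsCostSubsolution net Q 0 := by
  refine ⟨rfl, fun i => ?_⟩
  refine add_nonneg (hQ i) (Finset.sum_nonneg fun S _ => ?_)
  have := prob_mul_le (net := net) (some i) S (a := 0) (b := minOver 0 S)
    fun hi => le_minOver ⟨_, hi⟩ fun j _ => le_rfl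
  simpa using this

/-- Knaster–Tarski: the pointwise supremum `V` of all subsolutions is one, by monotonicity of
`costMap`. One application of `costMap` to `V` gives a subsolution above `V`, hence equal to `V`.
The supremum is finite because the whole node set is rooted. -/
theorem exists_greatest_subsolution (hconn : net.Connected) (hQ : ∀ i, 0 ≤ Q i) :
    ∃ V, IsCostFixedPoint net Q V ∧ ∀ W, IsCostSubsolution net Q W → W ≤ V := by
  have hbdd : ∀ a, BddAbove {x | ∃ W, IsCostSubsolution net Q W ∧ W a = x} := by
    intro a
    refine ⟨(∑ i, Q i) / net.pMin, ?_⟩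
    rintro x ⟨W, hW, rfl⟩
    exact hW.le_of_rooted hQ hconn.rooted_univ a (by simp)
  set V : Node N → ℝ := fun a => sSup {x | ∃ W, IsCostSubsolution net Q W ∧ W a = x} with hV
  have hle : ∀ W, IsCostSubsolution net Q W → W ≤ V := fun W hW a =>
    le_csSup (hbdd a) ⟨W, hW, rfl⟩
  have hsup : ∀ a c, (∀ W, IsCostSubsolution net Q W → W a ≤ c) → V a ≤ c := by
    intro a c h
    refine csSup_le ⟨_, 0, isCostSubsolution_zero hQ, rfl⟩ ?_
    rintro x ⟨W, hW, rfl⟩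
    exact h W hW
  have h0 : V none = 0 :=
    le_antisymm (hsup _ _ fun W hW => hW.1.le) (hle 0 (isCostSubsolution_zero hQ) none)
  have hsub : IsCostSubsolution net Q V :=
    ⟨h0, fun i => hsup _ _ fun W hW => (hW.2 i).trans (costMap_mono (hle W hW) i)⟩
  refine ⟨V, ⟨h0, fun i => le_antisymm (hsub.2 i) ?_⟩, hle⟩
  let V' : Node N → ℝ := fun a => a.elim 0 fun i => costMap net Q V i
  have hVV' : V ≤ V' := by
    intro a
    cases a with
    | none => exact h0.le
    | some i => exact hsub.2 i
  exact hle V' ⟨rfl, fun i => costMap_mono hVV' i⟩ (some i)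

theorem exists_isCongestionCost (hconn : net.Connected) (hQ : ∀ i, 0 ≤ Q i) :
    ∃ V, IsCongestionCost net Q V := by
  obtain ⟨V, hV, hle⟩ := exists_greatest_subsolution hconn hQ
  exact ⟨V, hV, fun W hW => hle W hW.isCostSubsolution⟩

theorem IsCongestionCost.le_of_subsolution (hconn : net.Connected) (hQ : ∀ i, 0 ≤ Q i)
    (hV : IsCongestionCost net Q V) (hW : IsCostSubsolution net Q W) : W ≤ V := by
  obtain ⟨V', hV', hle⟩ := exists_greatest_subsolution hconn hQ
  exact (hle W hW).trans (hV.2 hV')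

/-- Maximum principle. Among the nodes of largest gap `V - W > 0` take `i` with the least `W`.
Subtracting the two equations forces, for each possible `S`, the minimizer of `W` over `S` to have
the largest gap too, so its `W` is at least `W i`. Then `W i ≥ Q i + W i`, which is impossible for
`Q i > 0`. -/
theorem IsCostFixedPoint.eq_of_isCongestionCost (hQ : ∀ i, 0 < Q i)
    (hV : IsCongestionCost net Q V) (hW : IsCostFixedPoint net Q W) : W = V := by
  have hWV : W ≤ V := hV.2 hW
  by_contra hne
  obtain ⟨m, -, hm⟩ := Finset.exists_max_image univ (fun a => V a - W a) ⟨none, mem_univ _⟩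
  have hpos : 0 < V m - W m := by
    by_contra! h
    refine hne (funext fun a => le_antisymm (hWV a) ?_)
    linarith [hm a (mem_univ a)]
  obtain ⟨i, hi, hmin⟩ := Finset.exists_min_image (univ.filter fun a => V a - W a = V m - W m) W
    ⟨m, by simp⟩
  simp only [mem_filter, mem_univ, true_and] at hi hmin
  cases i with
  | none => rw [hV.1.1, hW.1] at hi; linarith
  | some i =>
    have key : ∀ S, net.prob (some i) S * minOver V S ≤
        net.prob (some i) S * (minOver W S + (V m - W m)) := fun S =>
      prob_mul_le _ _ fun hiS => by
        obtain ⟨j, hj, he⟩ := exists_minOver_eq W ⟨_, hiS⟩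
        linarith [minOver_le V hj, hm j (mem_univ j)]
    have hVi := hV.1.2 i
    have hWi := hW.2 i
    have hsum : ∑ S, net.prob (some i) S * (minOver W S + (V m - W m)) =
        ∑ S, net.prob (some i) S * minOver W S + (V m - W m) := by
      simp only [mul_add, Finset.sum_add_distrib, sum_prob_mul_const]
    have heq : ∑ S, net.prob (some i) S * minOver V S =
        ∑ S, net.prob (some i) S * (minOver W S + (V m - W m)) := by
      linarith
    have heqS := (Finset.sum_eq_sum_iff_of_le fun S _ => key S).1 heq
    have : ∑ S, net.prob (some i) S * W (some i) ≤ ∑ S, net.prob (some i) S * minOver W S := by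
      refine Finset.sum_le_sum fun S hS => ?_
      rcases (net.prob_nonneg (some i) S).eq_or_lt with h0 | h0
      · simp [← h0]
      · refine mul_le_mul_of_nonneg_left ?_ h0.le
        have h1 := mul_left_cancel₀ h0.ne' (heqS S hS)
        obtain ⟨j, hj, he⟩ := exists_minOver_eq W ⟨_, net.mem_of_prob_pos h0⟩
        rw [he]
        exact hmin j (le_antisymm (hm j (mem_univ j)) (by linarith [minOver_le V hj]))
    rw [sum_prob_mul_const] at this
    linarith [hQ i]

theorem IsCongestionCost.nonneg (hconn : net.Connected) (hQ : ∀ i, 0 ≤ Q i)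
    (hV : IsCongestionCost net Q V) (a : Node N) : 0 ≤ V a :=
  hV.le_of_subsolution hconn hQ (isCostSubsolution_zero hQ) a

theorem IsCongestionCost.backlog_le (hconn : net.Connected) (hQ : ∀ i, 0 ≤ Q i)
    (hV : IsCongestionCost net Q V) (i : Fin N) : Q i ≤ V (some i) := by
  rw [hV.1.2 i]
  have := Finset.sum_le_sum fun (S : Finset (Node N)) (_ : S ∈ univ) =>
    prob_mul_le (net := net) (some i) S (a := 0) (b := minOver V S)
      fun hi => le_minOver ⟨_, hi⟩ fun j _ => hV.nonneg hconn hQ j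
  rw [sum_prob_mul_const] at this
  linarith

/-- The sublevel sets of the congestion costs are rooted. -/
theorem IsCongestionCost.rooted_sublevel (hconn : net.Connected) (hQ : ∀ i, 0 ≤ Q i)
    (hV : IsCongestionCost net Q V) (x : ℝ) :
    net.Rooted (univ.filter fun i : Fin N => V (some i) ≤ x) := by
  intro W hW hne
  by_contra! hlink
  -- `δ` is the jump of `V` above level `x`. Raising `V` by `δ` on an exitless part `W` of the
  -- sublevel set will give a larger subsolution.
  obtain ⟨δ, hδ, hgap⟩ : ∃ δ > 0, ∀ i : Fin N, x < V (some i) → x + δ ≤ V (some i) := by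
    by_cases hG : (univ.filter fun i : Fin N => x < V (some i)).Nonempty
    · obtain ⟨i, hi, hmin⟩ := Finset.exists_min_image _ (fun i : Fin N => V (some i)) hG
      simp only [mem_filter, mem_univ, true_and] at hi hmin
      exact ⟨V (some i) - x, by linarith, fun j hj => by linarith [hmin j hj]⟩
    · refine ⟨1, one_pos, fun i hi => absurd ⟨i, ?_⟩ hG⟩
      simpa using hi
  let V' : Node N → ℝ := fun a => a.elim 0 fun i => V (some i) + if i ∈ W then δ else 0
  have hVV' : V ≤ V' := by
    intro a
    cases a with
    | none => exact hV.1.1.le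
    | some i =>
      show V (some i) ≤ V (some i) + if i ∈ W then δ else 0
      split_ifs <;> linarith
  have hsub : IsCostSubsolution net Q V' := by
    refine ⟨rfl, fun i => ?_⟩
    show V (some i) + (if i ∈ W then δ else 0) ≤ costMap net Q V' i
    split_ifs with hi
    · have hle : ∀ S, net.prob (some i) S * (minOver V S + δ) ≤
          net.prob (some i) S * minOver V' S := by
        intro S
        rcases (net.prob_nonneg (some i) S).eq_or_lt with h0 | h0
        · simp [← h0]
        refine mul_le_mul_of_nonneg_left ?_ h0.le
        have hiS := net.mem_of_prob_pos h0
        refine le_minOver ⟨_, hiS⟩ fun j hj => ?_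
        have hnl : j ∉ insertNone ((univ.filter fun i : Fin N => V (some i) ≤ x) \ W) :=
          -- As `W` has no exit into the rest of the sublevel set, a possible receiver `j` is either
          -- in `W`, and raised, or above level `x`, so that its cost is at least `x + δ ≥ V i + δ`.
          fun hj' => hlink i hi ⟨j, hj', S, hj, h0⟩
        cases j with
        | none => simp at hnl
        | some j =>
          show minOver V S + δ ≤ V (some j) + if j ∈ W then δ else 0
          split_ifs with hjW
          · linarith [minOver_le V hj]
          · simp only [some_mem_insertNone, mem_sdiff, mem_filter, mem_univ, true_and, hjW,
              not_false_eq_true, and_true, not_le] at hnl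
            have hix : V (some i) ≤ x := by simpa using hW hi
            linarith [hgap j hnl, minOver_le V hiS]
      have hs := Finset.sum_le_sum fun S (_ : S ∈ univ) => hle S
      simp only [mul_add, Finset.sum_add_distrib, sum_prob_mul_const] at hs
      unfold costMap
      linarith [hV.1.2 i]
    · rw [add_zero, hV.1.2 i]
      exact costMap_mono hVV' i
  obtain ⟨i, hi⟩ := hne
  have : V (some i) + (if i ∈ W then δ else 0) ≤ V (some i) :=
    hV.le_of_subsolution hconn hQ hsub (some i)
  rw [if_pos hi] at this
  linarith

/-- If no node outside the rooted set `A` that can be added to it has a small backlog, the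
congestion costs in `A` are smaller than those outside. -/
theorem IsCongestionCost.lt_of_marginal (hconn : net.Connected) (hQ : ∀ i, 0 ≤ Q i)
    (hV : IsCongestionCost net Q V) {A : Finset (Fin N)} (hA : net.Rooted A)
    (hlt : ∀ k ∉ A, net.Rooted (insert k A) → (∑ i ∈ A, Q i) / net.pMin < Q k)
    {a : Node N} (ha : a ∈ insertNone A) {b : Fin N} (hb : b ∉ A) : V a < V (some b) := by
  -- Rootedness of the sublevel set of `V b`, applied to its part outside `A`, which contains `b`,
  -- yields `k ∉ A` with `V k ≤ V b` linked to `A ∪ {0}`. Then `V a ≤ Q_A / p_min < Q k ≤ V k ≤ V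
  -- b`.
  obtain ⟨k, hk, hl⟩ := hV.rooted_sublevel hconn hQ (V (some b))
    ((univ.filter fun i : Fin N => V (some i) ≤ V (some b)) \ A) sdiff_subset
    ⟨b, by simp [hb]⟩
  rw [sdiff_sdiff_right_self] at hl
  simp only [mem_sdiff, mem_filter, mem_univ, true_and] at hk
  have h1 := hlt k hk.2 (hA.insert (hl.mono inter_subset_right))
  linarith [hV.1.isCostSubsolution.le_of_rooted hQ hA a ha, hV.backlog_le hconn hQ k]

end Routing

/-! ### Growth functions and lower hulls of rooted sets -/

namespace Routing

open Finset

variable {N : ℕ} {net : Network N}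

/-! ### Growth functions -/

/-- A strictly increasing function whose increments grow by the factor `1 / p`. -/
structure IsGrowth (p : ℝ) (φ : ℕ → ℝ) : Prop where
  zero : φ 0 = 0
  strictMono : StrictMono φ
  ratio : ∀ m n₁ n₂ : ℕ, 0 < n₁ → 0 < n₂ →
    (φ (m + n₁) - φ m) / p ≤ φ (m + n₁ + n₂) - φ (m + n₁)

/-- For `a ≤ b`, the increment from `b` to `c` is at least that from `m` to `b`, hence at least that
from `m` to `a`. This substitutes for supermodularity: it controls the union of two incomparable
sets containing a common base without reference to their intersection, which need not be rooted. -/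
theorem IsGrowth.add_le {φ : ℕ → ℝ} (hφ : IsGrowth net.pMin φ) {m a b c : ℕ}
    (hma : m ≤ a) (hmb : m ≤ b) (hac : a < c) (hbc : b < c) : φ a + φ b ≤ φ c + φ m := by
  wlog hab : a ≤ b generalizing a b
  · rw [add_comm (φ a)]
    exact this hmb hma hbc hac (le_of_not_ge hab)
  have h1 := hφ.strictMono.monotone hab
  rcases hmb.eq_or_lt with rfl | hlt
  · linarith [hφ.strictMono.monotone hac.le]
  · obtain ⟨n₁, rfl⟩ := Nat.exists_eq_add_of_le hmb
    obtain ⟨n₂, rfl⟩ := Nat.exists_eq_add_of_le hbc.le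
    have h2 := hφ.ratio m n₁ n₂ (by omega) (by omega)
    have h3 : φ (m + n₁) - φ m ≤ (φ (m + n₁) - φ m) / net.pMin :=
      le_div_self (by linarith [hφ.strictMono.monotone hmb]) net.pMin_pos net.pMin_le_one
    linarith

theorem IsGrowth.succ_sub_mono {φ : ℕ → ℝ} (hφ : IsGrowth net.pMin φ) {a b : ℕ} (h : a ≤ b) :
    φ (a + 1) - φ a ≤ φ (b + 1) - φ b := by
  rcases h.eq_or_lt with rfl | h
  · rfl
  · linarith [hφ.add_le (Nat.le_succ a) h.le (Nat.succ_lt_succ h) (Nat.lt_succ_self b)]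

/-- This is where the factor `1 / p_min` in the cost bound on a rooted set is absorbed. -/
theorem IsGrowth.div_le_succ_sub {φ : ℕ → ℝ} (hφ : IsGrowth net.pMin φ) (a : ℕ) :
    φ a / net.pMin ≤ φ (a + 1) - φ a := by
  rcases a.eq_zero_or_pos with rfl | ha
  · rw [hφ.zero, zero_div, sub_zero, ← hφ.zero]
    exact hφ.strictMono.monotone (Nat.zero_le _)
  · have := hφ.ratio 0 a 1 ha one_pos
    rwa [zero_add, hφ.zero, sub_zero] at this

/-- A rooted set whose mean backlog is smaller than the marginal backlog of any node that can be
added to it has smaller congestion costs than its complement. -/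
theorem IsCongestionCost.lt_of_mem_of_notMem {Q : Fin N → ℝ} {V : Node N → ℝ} {φ : ℕ → ℝ}
    (hφ : IsGrowth net.pMin φ) (hconn : net.Connected)
    (hQ : ∀ i, 0 ≤ Q i) (hV : IsCongestionCost net Q V) {A : Finset (Fin N)} (hA : net.Rooted A)
    {s : ℝ} (hs : 0 ≤ s) (hle : ∑ i ∈ A, Q i ≤ s * φ A.card)
    (hlt : ∀ k ∉ A, net.Rooted (insert k A) → s * (φ (A.card + 1) - φ A.card) < Q k)
    {a : Node N} (ha : a ∈ insertNone A) {b : Fin N} (hb : b ∉ A) : V a < V (some b) := by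
  refine hV.lt_of_marginal hconn hQ hA (fun k hk hr => lt_of_le_of_lt ?_ (hlt k hk hr)) ha hb
  calc (∑ i ∈ A, Q i) / net.pMin ≤ s * φ A.card / net.pMin :=
        div_le_div_of_nonneg_right hle net.pMin_pos.le
    _ = s * (φ A.card / net.pMin) := mul_div_assoc _ _ _
    _ ≤ _ := mul_le_mul_of_nonneg_left (hφ.div_le_succ_sub _) hs

/-! ### Lower hulls -/

/-- The slope of the chord from `B` to `B ∪ C` in the points `(φ |A|, Q_A)`. -/
noncomputable def chordSlope (φ : ℕ → ℝ) (Q : Fin N → ℝ) (B C : Finset (Fin N)) : ℝ :=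
  (∑ i ∈ C, Q i) / (φ (B ∪ C).card - φ B.card)

/-- The union of a list of classes. -/
def unionOf (l : List (Finset (Fin N))) : Finset (Fin N) := l.foldr (· ∪ ·) ∅

@[simp] theorem unionOf_nil : unionOf ([] : List (Finset (Fin N))) = ∅ := rfl

@[simp] theorem unionOf_cons (C : Finset (Fin N)) (l : List (Finset (Fin N))) :
    unionOf (C :: l) = C ∪ unionOf l := rfl

@[simp] theorem unionOf_append (l l' : List (Finset (Fin N))) :
    unionOf (l ++ l') = unionOf l ∪ unionOf l' := by
  induction l with
  | nil => simp
  | cons C l ih => simp [ih, union_assoc]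

theorem mem_unionOf {l : List (Finset (Fin N))} {i : Fin N} :
    i ∈ unionOf l ↔ ∃ C ∈ l, i ∈ C := by
  induction l with
  | nil => simp
  | cons C l ih => simp [ih]

/-- The list `l` of classes continues `B` to a chain of rooted sets that has increasing slopes and
locally forms a lower hull. -/
structure IsHull (net : Network N) (φ : ℕ → ℝ) (Q : Fin N → ℝ) (B : Finset (Fin N))
    (l : List (Finset (Fin N))) : Prop where
  nonempty : ∀ C ∈ l, C.Nonempty
  disjoint : l.Pairwise Disjoint
  disjoint_base : ∀ C ∈ l, Disjoint B C
  cover : B ∪ unionOf l = univ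
  rooted : ∀ pre post, l = pre ++ post → net.Rooted (B ∪ unionOf pre)
  slope_le : ∀ pre C post A, l = pre ++ C :: post → A ⊆ C → A.Nonempty →
    net.Rooted (B ∪ unionOf pre ∪ A) →
      chordSlope φ Q (B ∪ unionOf pre) C ≤ chordSlope φ Q (B ∪ unionOf pre) A
  slope_lt : ∀ pre C C' post, l = pre ++ C :: C' :: post →
    chordSlope φ Q (B ∪ unionOf pre) C < chordSlope φ Q (B ∪ unionOf pre ∪ C) C'

section Hull

variable {φ : ℕ → ℝ} {Q : Fin N → ℝ} {B : Finset (Fin N)}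

theorem card_lt_card_union {B C : Finset (Fin N)} (h : Disjoint B C) (hC : C.Nonempty) :
    B.card < (B ∪ C).card := by
  rw [card_union_of_disjoint h]
  have := hC.card_pos
  omega

theorem IsGrowth.sub_pos {p : ℝ} (hφ : IsGrowth p φ) {B C : Finset (Fin N)}
    (h : Disjoint B C) (hC : C.Nonempty) : 0 < φ (B ∪ C).card - φ B.card :=
  _root_.sub_pos.2 (hφ.strictMono (card_lt_card_union h hC))

theorem IsGrowth.le_chordSlope {p : ℝ} (hφ : IsGrowth p φ) {B C : Finset (Fin N)}
    (h : Disjoint B C) (hC : C.Nonempty) {s : ℝ} :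
    s ≤ chordSlope φ Q B C ↔ s * (φ (B ∪ C).card - φ B.card) ≤ ∑ i ∈ C, Q i :=
  le_div_iff₀ (hφ.sub_pos h hC)

theorem IsGrowth.chordSlope_le {p : ℝ} (hφ : IsGrowth p φ) {B C : Finset (Fin N)}
    (h : Disjoint B C) (hC : C.Nonempty) {s : ℝ} :
    chordSlope φ Q B C ≤ s ↔ ∑ i ∈ C, Q i ≤ s * (φ (B ∪ C).card - φ B.card) :=
  div_le_iff₀ (hφ.sub_pos h hC)

theorem IsGrowth.chordSlope_nonneg {p : ℝ} (hφ : IsGrowth p φ) (hQ : ∀ i, 0 ≤ Q i)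
    {B C : Finset (Fin N)} (h : Disjoint B C) (hC : C.Nonempty) : 0 ≤ chordSlope φ Q B C :=
  div_nonneg (Finset.sum_nonneg fun i _ => hQ i) (hφ.sub_pos h hC).le

theorem IsHull.tail {C : Finset (Fin N)} {l : List (Finset (Fin N))}
    (h : IsHull net φ Q B (C :: l)) : IsHull net φ Q (B ∪ C) l where
  nonempty D hD := h.nonempty D (List.mem_cons_of_mem _ hD)
  disjoint := h.disjoint.of_cons
  disjoint_base D hD := disjoint_union_left.2
    ⟨h.disjoint_base D (List.mem_cons_of_mem _ hD), List.rel_of_pairwise_cons h.disjoint hD⟩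
  cover := by rw [union_assoc]; exact h.cover
  rooted pre post hl := by
    rw [union_assoc]
    exact h.rooted (C :: pre) post (by rw [hl, List.cons_append])
  slope_le pre D post A hl := by
    rw [union_assoc B C]
    exact h.slope_le (C :: pre) D post A (by rw [hl, List.cons_append])
  slope_lt pre D D' post hl := by
    rw [union_assoc B C]
    exact h.slope_lt (C :: pre) D D' post (by rw [hl, List.cons_append])

theorem IsHull.drop {pre l : List (Finset (Fin N))} :
    ∀ {B : Finset (Fin N)}, IsHull net φ Q B (pre ++ l) → IsHull net φ Q (B ∪ unionOf pre) l := by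
  induction pre with
  | nil => intro B h; simpa using h
  | cons C pre ih =>
    intro B h
    rw [unionOf_cons, ← union_assoc]
    exact ih h.tail

theorem IsHull.cons {C : Finset (Fin N)} {l : List (Finset (Fin N))} (hC : C.Nonempty)
    (hBC : Disjoint B C) (hB : net.Rooted B) (h : IsHull net φ Q (B ∪ C) l)
    (hle : ∀ A ⊆ C, A.Nonempty → net.Rooted (B ∪ A) → chordSlope φ Q B C ≤ chordSlope φ Q B A)
    (hlt : ∀ C' l', l = C' :: l' → chordSlope φ Q B C < chordSlope φ Q (B ∪ C) C') :
    IsHull net φ Q B (C :: l) where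
  nonempty := by
    intro D hD
    rcases List.mem_cons.1 hD with rfl | hD
    exacts [hC, h.nonempty D hD]
  disjoint := List.pairwise_cons.2
    ⟨fun D hD => (disjoint_union_left.1 (h.disjoint_base D hD)).2, h.disjoint⟩
  disjoint_base := by
    intro D hD
    rcases List.mem_cons.1 hD with rfl | hD
    exacts [hBC, (disjoint_union_left.1 (h.disjoint_base D hD)).1]
  cover := by rw [unionOf_cons, ← union_assoc]; exact h.cover
  rooted pre post hl := by
    cases pre with
    | nil => simpa using hB
    | cons D pre =>
      obtain ⟨rfl, rfl⟩ := List.cons_eq_cons.1 hl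
      rw [unionOf_cons, ← union_assoc]
      exact h.rooted pre post rfl
  slope_le pre D post A hl hAD hA hr := by
    cases pre with
    | nil =>
      obtain ⟨rfl, rfl⟩ := List.cons_eq_cons.1 hl
      rw [unionOf_nil, union_empty] at hr ⊢
      exact hle A hAD hA hr
    | cons E pre =>
      obtain ⟨rfl, rfl⟩ := List.cons_eq_cons.1 hl
      rw [unionOf_cons, ← union_assoc] at hr ⊢
      exact h.slope_le pre D post A rfl hAD hA hr
  slope_lt pre D D' post hl := by
    cases pre with
    | nil =>
      obtain ⟨rfl, rfl⟩ := List.cons_eq_cons.1 hl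
      rw [unionOf_nil, union_empty]
      exact hlt D' post rfl
    | cons E pre =>
      obtain ⟨rfl, rfl⟩ := List.cons_eq_cons.1 hl
      rw [unionOf_cons, ← union_assoc]
      exact h.slope_lt pre D D' post rfl

/-- The slopes of a hull increase. -/
theorem IsHull.slope_lt_of_later {C' : Finset (Fin N)} {post : List (Finset (Fin N))} :
    ∀ {pre : List (Finset (Fin N))} {B C : Finset (Fin N)},
      IsHull net φ Q B (C :: (pre ++ C' :: post)) →
        chordSlope φ Q B C < chordSlope φ Q (B ∪ C ∪ unionOf pre) C' := by
  intro pre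
  induction pre with
  | nil => intro B C h; simpa using h.slope_lt [] C C' post rfl
  | cons D pre ih =>
    intro B C h
    have h1 : chordSlope φ Q B C < chordSlope φ Q (B ∪ C) D := by
      simpa using h.slope_lt [] C D _ rfl
    have h2 := ih h.tail
    rw [unionOf_cons, ← union_assoc]
    exact h1.trans h2

/-- All chords before `C` are less steep than that of `C`, and the increments of `φ` telescope. -/
theorem IsHull.sum_le (hφ : IsGrowth net.pMin φ)
    {C : Finset (Fin N)} {post : List (Finset (Fin N))} :
    ∀ {pre : List (Finset (Fin N))} {B : Finset (Fin N)}, IsHull net φ Q B (pre ++ C :: post) →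
      ∑ i ∈ unionOf pre, Q i ≤
        chordSlope φ Q (B ∪ unionOf pre) C * (φ (B ∪ unionOf pre).card - φ B.card) := by
  intro pre
  induction pre with
  | nil => intro B h; simp
  | cons D pre ih =>
    intro B h
    have h1 := ih h.tail
    have h2 := h.slope_lt_of_later
    have hBD := h.disjoint_base D List.mem_cons_self
    have hDne := h.nonempty D List.mem_cons_self
    have h3 := (hφ.chordSlope_le hBD hDne).1 h2.le
    have hdis : Disjoint D (unionOf pre) := by
      rw [disjoint_left]
      intro x hx hx'
      obtain ⟨E, hE, hxE⟩ := mem_unionOf.1 hx'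
      exact disjoint_left.1 (List.rel_of_pairwise_cons h.disjoint
        (List.mem_append_left _ hE)) hx hxE
    rw [unionOf_cons, sum_union hdis, ← union_assoc]
    linarith

/-- Locates the class at which the growing union first covers `D`. -/
theorem exists_split_of_subset {D : Finset (Fin N)} :
    ∀ {l : List (Finset (Fin N))} {B : Finset (Fin N)}, ¬ D ⊆ B → D ⊆ B ∪ unionOf l →
      ∃ pre C post, l = pre ++ C :: post ∧ ¬ D ⊆ B ∪ unionOf pre ∧
        D ⊆ B ∪ unionOf pre ∪ C := by
  intro l
  induction l with
  | nil => intro B h1 h2; simp at h2; exact absurd h2 h1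
  | cons C l ih =>
    intro B h1 h2
    by_cases h3 : D ⊆ B ∪ C
    · exact ⟨[], C, l, rfl, by simpa using h1, by simpa using h3⟩
    · rw [unionOf_cons, ← union_assoc] at h2
      obtain ⟨pre, C', post, rfl, h4, h5⟩ := ih h3 h2
      refine ⟨C :: pre, C', post, rfl, ?_, ?_⟩ <;> rwa [unionOf_cons, ← union_assoc]

/-- A set that is optimal from `B` and has at most the first slope of a hull from `B` lies in the
first class. -/
theorem IsHull.subset_first (hφ : IsGrowth net.pMin φ) (hQ : ∀ i, 0 ≤ Q i)
    {C D : Finset (Fin N)} {l : List (Finset (Fin N))} (h : IsHull net φ Q B (C :: l))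
    (hD : D.Nonempty) (hBD : Disjoint B D) (hr : net.Rooted (B ∪ D))
    (hopt : ∀ A ⊆ D, A.Nonempty → net.Rooted (B ∪ A) →
      chordSlope φ Q B D ≤ chordSlope φ Q B A)
    (hle : chordSlope φ Q B D ≤ chordSlope φ Q B C) : D ⊆ C := by
  have hDB : ¬ D ⊆ B := fun hsub => by
    obtain ⟨x, hx⟩ := hD
    exact disjoint_left.1 hBD (hsub hx) hx
  obtain ⟨pre, C', post, hl, hn, hsub⟩ := exists_split_of_subset (l := C :: l) hDB
    (by rw [h.cover]; exact subset_univ _)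
  cases pre with
  | nil =>
    obtain ⟨rfl, rfl⟩ := List.cons_eq_cons.1 hl
    intro x hx
    have := hsub hx
    simp only [unionOf_nil, union_empty, mem_union] at this
    exact this.resolve_left fun hxB => disjoint_left.1 hBD hxB hx
  | cons C₀ pre =>
    exfalso
    obtain ⟨rfl, rfl⟩ := List.cons_eq_cons.1 hl
    set s := chordSlope φ Q B D with hs
    set P := unionOf (C :: pre) with hP
    have hPC : Disjoint (B ∪ P) C' := by
      have := IsHull.drop (pre := C :: pre) h
      exact this.disjoint_base C' List.mem_cons_self
    have hlt : s < chordSlope φ Q (B ∪ P) C' := by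
      have := h.slope_lt_of_later
      rw [union_assoc] at this
      exact hle.trans_lt this
    have hBP : Disjoint B P := by
      rw [disjoint_left]
      intro x hx hx'
      obtain ⟨E, hE, hxE⟩ := mem_unionOf.1 hx'
      refine disjoint_left.1 (h.disjoint_base E ?_) hx hxE
      rcases List.mem_cons.1 hE with rfl | hE
      · exact List.mem_cons_self
      · exact List.mem_cons_of_mem _ (List.mem_append_left _ hE)
    have hPne : P.Nonempty := by
      obtain ⟨x, hx⟩ := h.nonempty C List.mem_cons_self
      exact ⟨x, mem_unionOf.2 ⟨C, List.mem_cons_self, hx⟩⟩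
    have hPr : net.Rooted (B ∪ P) := h.rooted (C :: pre) (C' :: post) rfl
    set E := D \ (B ∪ P) with hE
    have hEne : E.Nonempty := sdiff_nonempty.2 hn
    have hEC : E ⊆ C' := by
      intro x hx
      rw [hE, mem_sdiff] at hx
      exact (mem_union.1 (hsub hx.1)).resolve_left hx.2
    have hun : B ∪ P ∪ E = B ∪ P ∪ (B ∪ D) := by
      ext x
      simp only [hE, mem_union, mem_sdiff]
      tauto
    have hEd : Disjoint (B ∪ P) E := disjoint_sdiff
    -- `E`, the part of `D` in its last class, is a rooted continuation of `B ∪ P` and so steeper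
    -- than `s`. The rest of the proof bounds `Q_E` from above by a chord of slope `s`.
    have h1 : s < chordSlope φ Q (B ∪ P) E :=
      hlt.trans_le (h.slope_le (C :: pre) C' post E rfl hEC hEne
        (by rw [hun]; exact hPr.union hr))
    have h2 : ¬ ∑ i ∈ E, Q i ≤ s * (φ (B ∪ P ∪ E).card - φ (B ∪ P).card) := by
      rw [← hφ.chordSlope_le hEd hEne]
      exact not_le.2 h1
    apply h2
    have hsD : ∑ i ∈ D, Q i ≤ s * (φ (B ∪ D).card - φ B.card) :=
      (hφ.chordSlope_le hBD hD).1 le_rfl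
    -- If `P ⊆ D`, then `P` competes with `D`, and `Q_P` can be subtracted from `Q_D`. Otherwise `B
    -- ∪ P ∪ E` is strictly larger than `B ∪ D`, and the growth of `φ` leaves enough room for all of
    -- `Q_D`.
    by_cases hPD : P ⊆ D
    · have h3 := (hφ.le_chordSlope hBP hPne).1 (hopt P hPD hPne hPr)
      have hED : E = D \ P := by
        ext x
        simp only [hE, mem_sdiff, mem_union, not_or]
        exact ⟨fun h => ⟨h.1, h.2.2⟩,
          fun h => ⟨h.1, fun hB => disjoint_left.1 hBD hB h.1, h.2⟩⟩
      have h4 : B ∪ P ∪ E = B ∪ D := by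
        rw [hun]
        ext x
        simp only [mem_union]
        have := @hPD x
        tauto
      have h5 := sum_sdiff (f := Q) hPD
      rw [h4, hED]
      linarith
    · have h3 : ∑ i ∈ E, Q i ≤ ∑ i ∈ D, Q i :=
        sum_le_sum_of_subset_of_nonneg sdiff_subset fun i _ _ => hQ i
      have h4 : (B ∪ D).card < (B ∪ P ∪ E).card := by
        refine card_lt_card ((ssubset_iff_of_subset ?_).2 ?_)
        · rw [hun]; exact subset_union_right
        · obtain ⟨x, hx, hxD⟩ := not_subset.1 hPD
          refine ⟨x, mem_union_left _ (mem_union_right _ hx), fun h => ?_⟩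
          rcases mem_union.1 h with h | h
          exacts [disjoint_left.1 hBP h hx, hxD h]
      have h5 := hφ.add_le (card_le_card (subset_union_left : B ⊆ B ∪ D))
        (card_le_card (subset_union_left : B ⊆ B ∪ P)) h4 (card_lt_card_union hEd hEne)
      have hs0 : 0 ≤ s := hφ.chordSlope_nonneg hQ hBD hD
      calc _ ≤ s * (φ (B ∪ D).card - φ B.card) := h3.trans hsD
        _ ≤ _ := mul_le_mul_of_nonneg_left (by linarith) hs0

/-- Of two first classes, the less steep one lies in the other by `IsHull.subset_first`. It then
competes with that other class, so the slopes agree and the inclusion reverses. The tails are hulls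
from the same base. -/
theorem IsHull.unique (hφ : IsGrowth net.pMin φ) (hQ : ∀ i, 0 ≤ Q i) :
    ∀ {l l' : List (Finset (Fin N))} {B : Finset (Fin N)},
      IsHull net φ Q B l → IsHull net φ Q B l' → l = l' := by
  have hcons : ∀ {B C : Finset (Fin N)} {l}, IsHull net φ Q B (C :: l) →
      ¬ IsHull net φ Q B [] := by
    intro B C l h h'
    obtain ⟨x, hx⟩ := h.nonempty C List.mem_cons_self
    have hB : B = univ := by simpa using h'.cover
    exact disjoint_left.1 (h.disjoint_base C List.mem_cons_self) (hB ▸ mem_univ x) hx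
  have hfirst : ∀ {B C C' : Finset (Fin N)} {l l'}, IsHull net φ Q B (C :: l) →
      IsHull net φ Q B (C' :: l') → chordSlope φ Q B C ≤ chordSlope φ Q B C' → C ⊆ C' := by
    intro B C C' l l' h h' hle
    refine h'.subset_first hφ hQ (h.nonempty C List.mem_cons_self)
      (h.disjoint_base C List.mem_cons_self) ?_ ?_ hle
    · simpa using h.rooted [C] l rfl
    · intro A hA hne hr
      simpa using h.slope_le [] C l A rfl hA hne (by simpa using hr)
  have hroot : ∀ {B C : Finset (Fin N)} {l}, IsHull net φ Q B (C :: l) → net.Rooted (B ∪ C) := by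
    intro B C l h
    simpa using h.rooted [C] l rfl
  have heq : ∀ {B C C' : Finset (Fin N)} {l l'}, IsHull net φ Q B (C :: l) →
      IsHull net φ Q B (C' :: l') → chordSlope φ Q B C ≤ chordSlope φ Q B C' → C = C' := by
    intro B C C' l l' h h' hle
    have hsub := hfirst h h' hle
    refine hsub.antisymm (hfirst h' h ?_)
    simpa using h'.slope_le [] C' l' C rfl hsub (h.nonempty C List.mem_cons_self)
      (by simpa using hroot h)
  intro l
  induction l with
  | nil =>
    intro l' B h h'
    cases l' with
    | nil => rfl
    | cons C' l' => exact absurd h (hcons h')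
  | cons C l ih =>
    intro l' B h h'
    cases l' with
    | nil => exact absurd h' (hcons h)
    | cons C' l' =>
      have : C = C' := by
        rcases le_total (chordSlope φ Q B C) (chordSlope φ Q B C') with hle | hle
        exacts [heq h h' hle, (heq h' h hle).symm]
      subst this
      rw [ih h.tail h'.tail]

/-- There is a largest set of smallest slope. -/
theorem exists_best_class (hφ : IsGrowth net.pMin φ) (hQ : ∀ i, 0 ≤ Q i)
    (hconn : net.Connected) (hB : B ≠ univ) :
    ∃ C : Finset (Fin N), C.Nonempty ∧ Disjoint B C ∧ net.Rooted (B ∪ C) ∧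
      ∀ A : Finset (Fin N), A.Nonempty → Disjoint B A → net.Rooted (B ∪ A) →
        chordSlope φ Q B C ≤ chordSlope φ Q B A ∧
          (chordSlope φ Q B A ≤ chordSlope φ Q B C → A ⊆ C) := by
  classical
  set X := univ.filter fun A : Finset (Fin N) => A.Nonempty ∧ Disjoint B A ∧ net.Rooted (B ∪ A)
    with hX
  have hXne : X.Nonempty := by
    refine ⟨univ \ B, ?_⟩
    simp only [hX, mem_filter, mem_univ, true_and]
    refine ⟨?_, disjoint_sdiff, ?_⟩
    · rw [sdiff_nonempty]
      exact fun h => hB (univ_subset_iff.1 h)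
    · rw [union_sdiff_of_subset (subset_univ _)]
      exact hconn.rooted_univ
  obtain ⟨C₀, hC₀, hmin⟩ := exists_min_image X (chordSlope φ Q B) hXne
  obtain ⟨C, hC, hmax⟩ := exists_max_image
    (X.filter fun A => chordSlope φ Q B A = chordSlope φ Q B C₀) card ⟨C₀, by simp [hC₀]⟩
  simp only [mem_filter] at hC hmax
  have hCX := hC.1
  simp only [hX, mem_filter, mem_univ, true_and] at hCX
  refine ⟨C, hCX.1, hCX.2.1, hCX.2.2, fun A hA hBA hr => ?_⟩
  have hAX : A ∈ X := by
    simp only [hX, mem_filter, mem_univ, true_and]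
    exact ⟨hA, hBA, hr⟩
  refine ⟨hC.2.le.trans (hmin A hAX), fun hle => ?_⟩
  by_contra hAC
  have hU : B ∪ (A ∪ C) = (B ∪ A) ∪ (B ∪ C) := by
    ext x; simp only [mem_union]; tauto
  have hBU : Disjoint B (A ∪ C) := disjoint_union_right.2 ⟨hBA, hCX.2.1⟩
  have hUne : (A ∪ C).Nonempty := hA.mono subset_union_left
  have hUX : A ∪ C ∈ X := by
    simp only [hX, mem_filter, mem_univ, true_and]
    exact ⟨hUne, hBU, by rw [hU]; exact hr.union hCX.2.2⟩
  have hcardC : C.card < (A ∪ C).card := by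
    refine card_lt_card ((ssubset_iff_of_subset subset_union_right).2 ?_)
    obtain ⟨x, hx, hxC⟩ := not_subset.1 hAC
    exact ⟨x, mem_union_left _ hx, hxC⟩
  -- A union of two sets of least slope again has least slope: `Q` is subadditive because it is
  -- non-negative, and `φ` is controlled by `IsGrowth.add_le`. This contradicts the maximal
  -- cardinality of `C`.
  have hslope : chordSlope φ Q B (A ∪ C) ≤ chordSlope φ Q B C := by
    by_cases hCA : C ⊆ A
    · rw [union_eq_left.2 hCA]; exact hle
    · have hcardA : A.card < (A ∪ C).card := by
        refine card_lt_card ((ssubset_iff_of_subset subset_union_left).2 ?_)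
        obtain ⟨x, hx, hxC⟩ := not_subset.1 hCA
        exact ⟨x, mem_union_right _ hx, hxC⟩
      rw [hφ.chordSlope_le hBU hUne]
      have h1 := (hφ.chordSlope_le hBA hA).1 hle
      have h2 := (hφ.chordSlope_le hCX.2.1 hCX.1).1 (le_refl (chordSlope φ Q B C))
      have h3 : ∑ i ∈ A ∪ C, Q i ≤ ∑ i ∈ A, Q i + ∑ i ∈ C, Q i := by
        rw [← sum_union_inter]
        exact le_add_of_nonneg_right (sum_nonneg fun i _ => hQ i)
      have h4 := hφ.add_le (m := B.card) (a := (B ∪ A).card) (b := (B ∪ C).card)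
        (c := (B ∪ (A ∪ C)).card) (card_le_card subset_union_left)
        (card_le_card subset_union_left)
        (by rw [card_union_of_disjoint hBA, card_union_of_disjoint hBU]; omega)
        (by rw [card_union_of_disjoint hCX.2.1, card_union_of_disjoint hBU]; omega)
      have h5 := mul_le_mul_of_nonneg_left h4 (hφ.chordSlope_nonneg hQ hCX.2.1 hCX.1)
      linarith
  have hUC := hmax (A ∪ C) ⟨hUX, le_antisymm (hslope.trans hC.2.le) (hmin _ hUX)⟩
  omega

/-- Greedy construction: continue by the largest set of least slope. The slopes strictly increase,
since otherwise merging the next class would give a larger set of least slope. -/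
theorem exists_isHull (hφ : IsGrowth net.pMin φ) (hQ : ∀ i, 0 ≤ Q i) (hconn : net.Connected)
    (hB : net.Rooted B) : ∃ l, IsHull net φ Q B l := by
  induction hn : N - B.card using Nat.strong_induction_on generalizing B with
  | _ n ih =>
    by_cases hBu : B = univ
    · refine ⟨[], by simp, List.Pairwise.nil, by simp, by simpa using hBu, ?_, ?_, ?_⟩
      · intro pre post h
        rw [(List.append_eq_nil_iff.1 h.symm).1]
        simpa using hB
      · intro pre C post A h
        simp at h
      · intro pre C C' post h
        simp at h
    · obtain ⟨C, hC, hBC, hr, hbest⟩ := exists_best_class hφ hQ hconn hBu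
      have hcard := card_lt_card_union hBC hC
      have hN : (B ∪ C).card ≤ N := by simpa using card_le_univ (B ∪ C)
      obtain ⟨l, hl⟩ := ih (N - (B ∪ C).card) (by omega) hr rfl
      refine ⟨C :: l, hl.cons hC hBC hB ?_ ?_⟩
      · intro A hAC hA hrA
        exact (hbest A hA (hBC.mono_right hAC) hrA).1
      · rintro C' l' rfl
        have hd := hl.disjoint_base C' List.mem_cons_self
        have hC' := hl.nonempty C' List.mem_cons_self
        have hd' := disjoint_union_left.1 hd
        have hrC' : net.Rooted (B ∪ (C ∪ C')) := by
          simpa [union_assoc] using hl.rooted [C'] l' rfl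
        have hd2 : Disjoint B (C ∪ C') := disjoint_union_right.2 ⟨hBC, hd'.1⟩
        have hne : (C ∪ C').Nonempty := hC.mono subset_union_left
        by_contra! hle
        have h1 := (hφ.chordSlope_le hd hC').1 hle
        have h2 := (hφ.chordSlope_le hBC hC).1 (le_refl (chordSlope φ Q B C))
        have h3 : C ∪ C' ⊆ C := by
          refine (hbest _ hne hd2 hrC').2 ((hφ.chordSlope_le hd2 hne).2 ?_)
          rw [sum_union hd'.2, ← union_assoc]
          linarith
        obtain ⟨x, hx⟩ := hC'
        exact disjoint_left.1 hd'.2 (h3 (mem_union_right _ hx)) hx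

/-- The congestion costs increase strictly across the prefixes of a hull. -/
theorem IsHull.congestionCost_lt (hφ : IsGrowth net.pMin φ) (hQ : ∀ i, 0 ≤ Q i)
    (hconn : net.Connected) {V : Node N → ℝ} (hV : IsCongestionCost net Q V)
    {pre : List (Finset (Fin N))} {C : Finset (Fin N)} {post : List (Finset (Fin N))}
    (h : IsHull net φ Q ∅ (pre ++ C :: post)) {a : Node N}
    (ha : a ∈ insertNone (unionOf pre ∪ C)) {b : Fin N} (hb : b ∉ unionOf pre ∪ C) :
    V a < V (some b) := by
  have h1 := IsHull.drop h
  have h2 := IsHull.sum_le hφ h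
  rw [empty_union] at h1 h2
  rw [card_empty, hφ.zero, sub_zero] at h2
  have hd := h1.disjoint_base C List.mem_cons_self
  have hne := h1.nonempty C List.mem_cons_self
  set s := chordSlope φ Q (unionOf pre) C with hs
  have hs0 : 0 ≤ s := hφ.chordSlope_nonneg hQ hd hne
  have h3 := (hφ.chordSlope_le hd hne).1 (le_refl (chordSlope φ Q (unionOf pre) C))
  refine hV.lt_of_mem_of_notMem hφ hconn hQ (A := unionOf pre ∪ C) ?_ hs0 ?_ ?_ ha hb
  · simpa using h1.rooted [C] post rfl
  · rw [sum_union hd]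
    linarith
  · intro k hk hr
    have hku : k ∈ unionOf pre ∪ (C ∪ unionOf post) := by
      have := h1.cover
      rw [unionOf_cons] at this
      rw [this]
      exact mem_univ k
    -- `k` lies in a later class `C'`. It can also be added to the prefix `X` just before `C'`,
    -- because unions of rooted sets are rooted, so `{k}` competes with `C'` there. The increments
    -- of `φ` increase, which carries the bound from `X` back to the shorter prefix.
    have hkp : k ∈ unionOf post := by
      rw [← union_assoc] at hku
      exact (mem_union.1 hku).resolve_left hk
    obtain ⟨C', hC', hkC'⟩ := mem_unionOf.1 hkp
    obtain ⟨mid, post', rfl⟩ := List.append_of_mem hC'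
    have h4 := h1.slope_lt_of_later
    have h5 := IsHull.drop h1.tail
    set X := unionOf pre ∪ C ∪ unionOf mid with hX
    have hdX := h5.disjoint_base C' List.mem_cons_self
    have hkX : k ∉ X := fun hkX => disjoint_left.1 hdX hkX hkC'
    have hXr : net.Rooted X := by simpa using h5.rooted [] _ rfl
    have hkXd : Disjoint X {k} := disjoint_singleton_right.2 hkX
    have h6 : chordSlope φ Q X C' ≤ chordSlope φ Q X {k} := by
      have hXk : X ∪ {k} = insert k (unionOf pre ∪ C) ∪ X := by
        ext x
        simp only [hX, mem_union, mem_singleton, mem_insert]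
        tauto
      have := h5.slope_le [] C' post' {k} rfl (singleton_subset_iff.2 hkC')
        (singleton_nonempty k)
      rw [unionOf_nil, union_empty, hXk] at this
      exact this (hr.union hXr)
    have h7 := (hφ.le_chordSlope hkXd (singleton_nonempty k)).1 h6
    rw [sum_singleton, card_union_of_disjoint hkXd, card_singleton] at h7
    have h8 : (unionOf pre ∪ C).card ≤ X.card := card_le_card subset_union_left
    have h9 := hφ.succ_sub_mono h8
    have h10 : 0 < φ (X.card + 1) - φ X.card := _root_.sub_pos.2 (hφ.strictMono (Nat.lt_succ_self _))
    calc s * (φ ((unionOf pre ∪ C).card + 1) - φ (unionOf pre ∪ C).card)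
        ≤ s * (φ (X.card + 1) - φ X.card) := mul_le_mul_of_nonneg_left h9 hs0
      _ < chordSlope φ Q X C' * (φ (X.card + 1) - φ X.card) := mul_lt_mul_of_pos_right h4 h10
      _ ≤ Q k := h7

end Hull

end Routing

/-! ### Rank orderings as hulls; existence of ORCD policies -/

namespace Routing

open Finset

variable {N : ℕ} {net : Network N}

/-! ### The growth function of a bivariate function -/

/-- The function `φ` with `1 / f(m,n) = φ(m+n) - φ(m)`. -/
noncomputable def growthOf (f : ℕ → ℕ → ℝ) (n : ℕ) : ℝ := if n = 0 then 0 else 1 / f 0 n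

/-- (C1) with first argument 0. Neither it nor the value `growthOf f 0 = 0` involves `f m 0`, which
is arbitrary. -/
theorem growthOf_add {f : ℕ → ℕ → ℝ} (hC1 : CondC1 f) (m : ℕ) {n : ℕ} (hn : 0 < n) :
    growthOf f (m + n) - growthOf f m = 1 / f m n := by
  rcases m.eq_zero_or_pos with rfl | hm
  · simp [growthOf, hn.ne']
  · have := hC1 0 m n hm hn
    rw [zero_add] at this
    rw [growthOf, growthOf, if_neg (by omega), if_neg hm.ne', this]
    ring

theorem isGrowth_growthOf {f : ℕ → ℕ → ℝ} (hpos : ∀ m n, 0 < n → 0 < f m n) (hC1 : CondC1 f)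
    (hratio : CondRatio net f) : IsGrowth net.pMin (growthOf f) where
  zero := if_pos rfl
  strictMono := strictMono_nat_of_lt_succ fun n => by
    have h1 := growthOf_add hC1 n one_pos
    have h2 := one_div_pos.2 (hpos n 1 one_pos)
    linarith
  ratio m n₁ n₂ h₁ h₂ := by
    rw [growthOf_add hC1 m h₁, growthOf_add hC1 (m + n₁) h₂]
    have h := hratio m n₁ n₂ h₁ h₂
    have hf1 := hpos m n₁ h₁
    calc 1 / f m n₁ / net.pMin = 1 / net.pMin * (1 / f m n₁) := by ring
      _ ≤ f m n₁ / f (m + n₁) n₂ * (1 / f m n₁) :=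
        mul_le_mul_of_nonneg_right h (one_div_pos.2 hf1).le
      _ = 1 / f (m + n₁) n₂ := by field_simp

theorem mul_sum_eq_chordSlope {f : ℕ → ℕ → ℝ} (hC1 : CondC1 f) (Q : Fin N → ℝ)
    {B C : Finset (Fin N)} (h : Disjoint B C) (hC : C.Nonempty) :
    f B.card C.card * ∑ i ∈ C, Q i = chordSlope (growthOf f) Q B C := by
  rw [chordSlope, card_union_of_disjoint h, growthOf_add hC1 _ hC.card_pos, div_div_eq_mul_div,
    div_one, mul_comm]

/-- A first chord is less steep than the second one if it is less steep than their union. -/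
theorem chordSlope_lt_iff {p : ℝ} {φ : ℕ → ℝ} (hφ : IsGrowth p φ) (Q : Fin N → ℝ)
    {B C D : Finset (Fin N)} (hBC : Disjoint B C) (hC : C.Nonempty) (hD : D.Nonempty)
    (hBD : Disjoint B D) (hCD : Disjoint C D) :
    chordSlope φ Q B C < chordSlope φ Q (B ∪ C) D ↔
      chordSlope φ Q B C < chordSlope φ Q B (C ∪ D) := by
  have h1 := (hφ.chordSlope_le (Q := Q) hBC hC).1 le_rfl
  have h2 := (hφ.le_chordSlope (Q := Q) hBC hC).1 le_rfl
  rw [← not_le, ← not_le, hφ.chordSlope_le (disjoint_union_left.2 ⟨hBD, hCD⟩) hD,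
    hφ.chordSlope_le (disjoint_union_right.2 ⟨hBC, hBD⟩) (hC.mono subset_union_left),
    sum_union hCD, ← union_assoc, not_iff_not]
  constructor <;> intro h <;> linarith

/-! ### Rank orderings as lists of classes -/

namespace RankOrdering

theorem ext_classes {R R' : RankOrdering N} (h : R.classes = R'.classes) : R = R' := by
  cases R; cases R'; cases h; rfl

variable (R : RankOrdering N)

theorem cls_of_classes_eq {R : RankOrdering N} {pre : List (Finset (Fin N))}
    {C : Finset (Fin N)} {post : List (Finset (Fin N))} (h : R.classes = pre ++ C :: post) :
    R.cls pre.length = C := by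
  simp [cls, h]

theorem mem_below {n : ℕ} {i : Fin N} : i ∈ R.below n ↔ ∃ k < n, i ∈ R.cls k := by
  simp [below]

theorem below_eq (n : ℕ) : R.below n = unionOf (R.classes.take n) := by
  ext i
  rw [mem_below, mem_unionOf]
  constructor
  · rintro ⟨k, hk, hi⟩
    by_cases hlen : k < R.classes.length
    · rw [cls, List.getD_eq_getElem _ _ hlen] at hi
      exact ⟨_, List.mem_take_iff_getElem.2 ⟨k, by omega, rfl⟩, hi⟩
    · rw [cls, List.getD_eq_default _ _ (not_lt.1 hlen)] at hi
      exact absurd hi (notMem_empty i)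
  · rintro ⟨C, hC, hi⟩
    obtain ⟨k, hk, rfl⟩ := List.mem_take_iff_getElem.1 hC
    refine ⟨k, by omega, ?_⟩
    rwa [cls, List.getD_eq_getElem _ _ (by omega)]

theorem below_of_classes_eq {R : RankOrdering N} {pre post : List (Finset (Fin N))}
    (h : R.classes = pre ++ post) : R.below pre.length = unionOf pre := by
  rw [below_eq, h, List.take_left']
  rfl

theorem rank_le_iff {n : ℕ} {i : Fin N} : R.rank (some i) ≤ n ↔ i ∈ R.below n := by
  rw [mem_below]
  constructor
  · intro h
    obtain ⟨C, hC, hi⟩ := R.cover i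
    have hlt : R.classes.findIdx (fun C => decide (i ∈ C)) < R.classes.length :=
      List.findIdx_lt_length.2 ⟨C, hC, by simpa using hi⟩
    refine ⟨_, h, ?_⟩
    rw [cls, List.getD_eq_getElem _ _ hlt]
    simpa using List.findIdx_getElem (w := hlt)
  · rintro ⟨k, hk, hi⟩
    by_contra! hlt
    have hkf : k < R.classes.findIdx (fun C => decide (i ∈ C)) := by
      have : R.rank (some i) = R.classes.findIdx (fun C => decide (i ∈ C)) + 1 := rfl
      omega
    have := List.not_of_lt_findIdx hkf
    rw [cls, List.getD_eq_getElem _ _ (hkf.trans_le List.findIdx_le_length)] at hi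
    simp [hi] at this

/-- A path through nodes of no higher rank than its start stays in every prefix containing the
start; conversely, the prefix ending with the class of `i` contains a simple path from `i`. -/
theorem pathConnected_iff : R.PathConnected net ↔
    ∀ pre post, R.classes = pre ++ post → net.Rooted (unionOf pre) := by
  constructor
  · intro h pre post hR W hW ⟨i, hi⟩
    rw [← below_of_classes_eq hR] at hW ⊢
    obtain ⟨l, -, hl, hle⟩ := h i
    refine Network.exists_links_of_path l i hi hl fun j hj => ?_
    rw [← rank_le_iff]
    exact (hle j hj).trans ((R.rank_le_iff).2 (hW hi))
  · intro h i
    have hr : net.Rooted (R.below (R.rank (some i))) := by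
      rw [below_eq]
      exact h _ _ (List.take_append_drop _ _).symm
    obtain ⟨l, hn, hp, hl⟩ := hr.exists_path i (R.rank_le_iff.1 le_rfl)
    exact ⟨l, hn.of_cons, hp, fun j hj => R.rank_le_iff.2 (hl j hj)⟩

theorem disjoint_unionOf {pre : List (Finset (Fin N))} {C : Finset (Fin N)}
    {post : List (Finset (Fin N))} (h : (pre ++ C :: post).Pairwise Disjoint) :
    Disjoint (unionOf pre) C := by
  rw [disjoint_left]
  intro x hx
  obtain ⟨D, hD, hxD⟩ := mem_unionOf.1 hx
  exact disjoint_left.1 ((List.pairwise_append.1 h).2.2 D hD C List.mem_cons_self) hxD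

variable {R}

theorem cls_congr {R' : RankOrdering N} {pre post post' : List (Finset (Fin N))}
    (h : R.classes = pre ++ post) (h' : R'.classes = pre ++ post') {k : ℕ} (hk : k < pre.length) :
    R.cls k = R'.cls k := by
  rw [cls, cls, h, h', List.getD_append _ _ _ _ hk, List.getD_append _ _ _ _ hk]

theorem mismatch_eq {R' : RankOrdering N} {pre post post' : List (Finset (Fin N))}
    {C C' : Finset (Fin N)} (h : R.classes = pre ++ C :: post)
    (h' : R'.classes = pre ++ C' :: post') (hne : C ≠ C') :
    R.mismatch R' = pre.length + 1 := by
  have hmem : pre.length ∈ {k | R.cls k ≠ R'.cls k} := by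
    show R.cls _ ≠ R'.cls _
    rwa [cls_of_classes_eq h, cls_of_classes_eq h']
  refine congrArg (· + 1) (le_antisymm (Nat.sInf_le hmem) ?_)
  refine le_csInf ⟨_, hmem⟩ fun k hk => ?_
  by_contra! hlt
  exact hk (cls_congr h h' hlt)

/-- The terms of the common prefix cancel, so only the first differing class matters. -/
theorem penalty_lt_iff {f : ℕ → ℕ → ℝ} {Q : Fin N → ℝ} {R' : RankOrdering N}
    {pre post post' : List (Finset (Fin N))}
    {C C' : Finset (Fin N)} (h : R.classes = pre ++ C :: post)
    (h' : R'.classes = pre ++ C' :: post') :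
    R'.penalty f Q (pre.length + 1) - R.penalty f Q (pre.length + 1) =
      f (unionOf pre).card C'.card * ∑ i ∈ C', Q i - f (unionOf pre).card C.card * ∑ i ∈ C, Q i := by
  have hcls : ∀ k < pre.length, R.cls k = R'.cls k := fun k hk =>
    cls_congr h h' hk
  have hbelow : ∀ k < pre.length, R.below k = R'.below k := fun k hk => by
    ext i
    rw [mem_below, mem_below]
    refine exists_congr fun j => and_congr_right fun hj => ?_
    rw [hcls j (hj.trans hk)]
  have hsum : ∑ k ∈ range pre.length, f (R.below k).card (R.cls k).card * ∑ i ∈ R.cls k, Q i =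
      ∑ k ∈ range pre.length, f (R'.below k).card (R'.cls k).card * ∑ i ∈ R'.cls k, Q i :=
    sum_congr rfl fun k hk => by rw [hbelow k (mem_range.1 hk), hcls k (mem_range.1 hk)]
  rw [penalty, penalty, sum_range_succ, sum_range_succ, cls_of_classes_eq h,
    cls_of_classes_eq h', below_of_classes_eq h, below_of_classes_eq h', hsum]
  ring

theorem penalizesLess_iff {f : ℕ → ℕ → ℝ} (hC1 : CondC1 f) {Q : Fin N → ℝ}
    {R' : RankOrdering N} {pre post post' : List (Finset (Fin N))}
    {C C' : Finset (Fin N)} (h : R.classes = pre ++ C :: post)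
    (h' : R'.classes = pre ++ C' :: post') (hne : C ≠ C') :
    R.PenalizesLess f Q R' ↔
      chordSlope (growthOf f) Q (unionOf pre) C < chordSlope (growthOf f) Q (unionOf pre) C' ∨
      (chordSlope (growthOf f) Q (unionOf pre) C = chordSlope (growthOf f) Q (unionOf pre) C' ∧
        R'.IsOneStepRefinement R) := by
  have hp := penalty_lt_iff (f := f) (Q := Q) h h'
  rw [mul_sum_eq_chordSlope hC1 Q (disjoint_unionOf (h ▸ R.disjoint))
      (R.nonempty C (by simp [h])),
    mul_sum_eq_chordSlope hC1 Q (disjoint_unionOf (h' ▸ R'.disjoint))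
      (R'.nonempty C' (by simp [h']))] at hp
  rw [PenalizesLess, mismatch_eq h h' hne]
  refine or_congr ?_ (and_congr_left fun _ => ?_)
  · constructor <;> intro _ <;> linarith
  · constructor <;> intro _ <;> linarith

theorem IsOneStepRefinement.length {R R' : RankOrdering N} (h : R'.IsOneStepRefinement R) :
    R'.classes.length = R.classes.length + 1 := by
  obtain ⟨pre, post, A, D, h1, h2⟩ := h
  simp [h1, h2]
  omega

theorem IsOneStepRefinement.asymm {R R' : RankOrdering N} (h : R'.IsOneStepRefinement R) :
    ¬ R.IsOneStepRefinement R' := fun h' => by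
  have := h.length
  have := h'.length
  omega

/-- The rank ordering that splits the class `C` into `A` and `C \ A`. -/
def split (R : RankOrdering N) {pre : List (Finset (Fin N))} {C : Finset (Fin N)}
    {post : List (Finset (Fin N))} (h : R.classes = pre ++ C :: post) {A : Finset (Fin N)}
    (hA : A.Nonempty) (hAC : A ⊂ C) : RankOrdering N where
  classes := pre ++ A :: (C \ A) :: post
  nonempty D hD := by
    simp only [List.mem_append, List.mem_cons] at hD
    rcases hD with hD | rfl | rfl | hD
    · exact R.nonempty D (by simp [h, hD])
    · exact hA
    · exact sdiff_nonempty.2 hAC.2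
    · exact R.nonempty D (by simp [h, hD])
  disjoint := by
    have hd := R.disjoint
    rw [h] at hd
    simp only [List.pairwise_append, List.pairwise_cons, List.mem_cons] at hd ⊢
    obtain ⟨h1, ⟨h2, h3⟩, h4⟩ := hd
    refine ⟨h1, ⟨?_, fun D hD => (h2 D hD).mono_left sdiff_subset, h3⟩, ?_⟩
    · rintro D (rfl | hD)
      exacts [disjoint_sdiff, (h2 D hD).mono_left hAC.1]
    · rintro D hD E (rfl | rfl | hE)
      exacts [(h4 D hD C (Or.inl rfl)).mono_right hAC.1,
        (h4 D hD C (Or.inl rfl)).mono_right sdiff_subset, h4 D hD E (Or.inr hE)]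
  cover i := by
    obtain ⟨D, hD, hi⟩ := R.cover i
    rw [h, List.mem_append, List.mem_cons] at hD
    rcases hD with hD | rfl | hD
    · exact ⟨D, by simp [hD], hi⟩
    · by_cases hiA : i ∈ A
      · exact ⟨A, by simp, hiA⟩
      · exact ⟨D \ A, by simp, mem_sdiff.2 ⟨hi, hiA⟩⟩
    · exact ⟨D, by simp [hD], hi⟩

/-- The rank ordering that merges the classes `C` and `D`. -/
def merge (R : RankOrdering N) {pre : List (Finset (Fin N))} {C D : Finset (Fin N)}
    {post : List (Finset (Fin N))} (h : R.classes = pre ++ C :: D :: post) : RankOrdering N where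
  classes := pre ++ (C ∪ D) :: post
  nonempty E hE := by
    simp only [List.mem_append, List.mem_cons] at hE
    rcases hE with hE | rfl | hE
    · exact R.nonempty E (by simp [h, hE])
    · exact (R.nonempty C (by simp [h])).mono subset_union_left
    · exact R.nonempty E (by simp [h, hE])
  disjoint := by
    have hd := R.disjoint
    rw [h] at hd
    simp only [List.pairwise_append, List.pairwise_cons, List.mem_cons] at hd ⊢
    obtain ⟨h1, ⟨h2, h3, h4⟩, h5⟩ := hd
    refine ⟨h1, ⟨fun E hE => disjoint_union_left.2 ⟨h2 E (Or.inr hE), h3 E hE⟩, h4⟩, ?_⟩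
    rintro E hE F (rfl | hF)
    exacts [disjoint_union_right.2 ⟨h5 E hE C (Or.inl rfl), h5 E hE D (Or.inr (Or.inl rfl))⟩,
      h5 E hE F (Or.inr (Or.inr hF))]
  cover i := by
    obtain ⟨E, hE, hi⟩ := R.cover i
    rw [h, List.mem_append, List.mem_cons, List.mem_cons] at hE
    rcases hE with hE | rfl | rfl | hE
    · exact ⟨E, by simp [hE], hi⟩
    · exact ⟨E ∪ D, by simp, mem_union_left _ hi⟩
    · exact ⟨C ∪ E, by simp, mem_union_right _ hi⟩
    · exact ⟨E, by simp [hE], hi⟩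

theorem split_pathConnected {R : RankOrdering N} (hR : R.PathConnected net)
    {pre : List (Finset (Fin N))} {C : Finset (Fin N)}
    {post : List (Finset (Fin N))} (h : R.classes = pre ++ C :: post) {A : Finset (Fin N)}
    (hA : A.Nonempty) (hAC : A ⊂ C) (hr : net.Rooted (unionOf pre ∪ A)) :
    (R.split h hA hAC).PathConnected net := by
  rw [pathConnected_iff] at hR ⊢
  intro p q hpq
  change pre ++ A :: (C \ A) :: post = p ++ q at hpq
  -- Only the cut between `A` and `C \ A` gives a new prefix union; every other one already occurs
  -- for `R`.
  rcases List.append_eq_append_iff.1 hpq with ⟨a, rfl, ha⟩ | ⟨c, rfl, hc⟩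
  · match a, ha with
    | [], _ => simpa using hR pre _ h
    | [X], ha =>
      obtain ⟨rfl, -⟩ := List.cons_eq_cons.1 ha
      simpa using hr
    | X :: Y :: a, ha =>
      obtain ⟨hX, ha⟩ := List.cons_eq_cons.1 ha
      obtain ⟨hY, hpost⟩ := List.cons_eq_cons.1 ha
      subst hX hY hpost
      have := hR (pre ++ C :: a) q (by rw [h]; simp)
      rw [unionOf_append, unionOf_cons] at this
      rw [unionOf_append, unionOf_cons, unionOf_cons, ← union_assoc A,
        union_sdiff_of_subset hAC.1]
      exact this
  · exact hR p _ (by rw [h, List.append_assoc])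

theorem merge_pathConnected {R : RankOrdering N} (hR : R.PathConnected net)
    {pre : List (Finset (Fin N))} {C D : Finset (Fin N)}
    {post : List (Finset (Fin N))} (h : R.classes = pre ++ C :: D :: post) :
    (R.merge h).PathConnected net := by
  rw [pathConnected_iff] at hR ⊢
  intro p q hpq
  change pre ++ (C ∪ D) :: post = p ++ q at hpq
  rcases List.append_eq_append_iff.1 hpq with ⟨a, rfl, ha⟩ | ⟨c, rfl, hc⟩
  · cases a with
    | nil => simpa using hR pre _ h
    | cons X a =>
      obtain ⟨rfl, rfl⟩ := List.cons_eq_cons.1 ha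
      simpa [union_assoc] using hR (pre ++ C :: D :: a) q (by rw [h]; simp)
  · exact hR p _ (by rw [h, List.append_assoc])

/-- Comparison with the splits of a class is `slope_le`, with equality allowed because ties favour
the coarser ordering. Comparison with the merger of two consecutive classes is strict for the same
reason, and `chordSlope_lt_iff` turns it into `slope_lt`. -/
theorem isPathConnectedFRanking_iff {f : ℕ → ℕ → ℝ} (hpos : ∀ m n, 0 < n → 0 < f m n)
    (hC1 : CondC1 f) (hratio : CondRatio net f) (Q : Fin N → ℝ) :
    R.IsPathConnectedFRanking net f Q ↔ IsHull net (growthOf f) Q ∅ R.classes := by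
  have hφ := isGrowth_growthOf hpos hC1 hratio
  constructor
  · rintro ⟨hR, hadj⟩
    refine ⟨R.nonempty, R.disjoint, fun _ _ => disjoint_empty_left _, ?_, ?_, ?_, ?_⟩
    · rw [empty_union, eq_univ_iff_forall]
      exact fun i => mem_unionOf.2 (R.cover i)
    · intro pre post h
      rw [empty_union]
      exact R.pathConnected_iff.1 hR pre post h
    · intro pre C post A h hAC hA hr
      rw [empty_union] at hr ⊢
      rcases hAC.eq_or_ssubset with rfl | hAC
      · rfl
      have href : (R.split h hA hAC).IsOneStepRefinement R :=
        ⟨pre, post, A, C \ A, by rw [union_sdiff_of_subset hAC.1, h], rfl⟩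
      have := hadj (R.split h hA hAC) (split_pathConnected hR h hA hAC hr) (Or.inl href)
      rcases (penalizesLess_iff hC1 h (R' := R.split h hA hAC) rfl hAC.ne').1 this with h1 | h1
      exacts [h1.le, h1.1.le]
    · intro pre C D post h
      rw [empty_union]
      have href : R.IsOneStepRefinement (R.merge h) := ⟨pre, post, C, D, rfl, h⟩
      have hd := R.disjoint
      rw [h] at hd
      have hdC := disjoint_unionOf hd
      have hdD : Disjoint (unionOf (pre ++ [C])) D := by
        refine disjoint_unionOf (post := post) ?_
        simpa using hd
      simp only [unionOf_append, unionOf_cons, unionOf_nil, union_empty] at hdD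
      have hdD' := disjoint_union_left.1 hdD
      have hneC := R.nonempty C (by simp [h])
      have hneD := R.nonempty D (by simp [h])
      have hne : C ≠ C ∪ D := fun he => by
        obtain ⟨x, hx⟩ := hneD
        exact disjoint_left.1 hdD'.2 (he ▸ mem_union_right _ hx) hx
      have := hadj (R.merge h) (merge_pathConnected hR h) (Or.inr href)
      rw [chordSlope_lt_iff hφ Q hdC hneC hneD hdD'.1 hdD'.2]
      rcases (penalizesLess_iff hC1 h (R' := R.merge h) rfl hne).1 this with h1 | h1
      exacts [h1, absurd h1.2 href.asymm]
  · intro hH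
    refine ⟨R.pathConnected_iff.2 fun pre post h => by simpa using hH.rooted pre post h, ?_⟩
    rintro R' hR' (⟨pre, post, A, D, h, h'⟩ | ⟨pre, post, A, D, h', h⟩)
    · have hneA := R'.nonempty A (by simp [h'])
      have hneD := R'.nonempty D (by simp [h'])
      have hd := R'.disjoint
      rw [h', List.pairwise_append, List.pairwise_cons] at hd
      have hAD : Disjoint A D := hd.2.1.1 D List.mem_cons_self
      have hne : A ∪ D ≠ A := fun he => by
        obtain ⟨x, hx⟩ := hneD
        exact disjoint_left.1 hAD (he ▸ mem_union_right _ hx) hx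
      rw [penalizesLess_iff hC1 h h' hne]
      have hr : net.Rooted (unionOf pre ∪ A) := by
        simpa using R'.pathConnected_iff.1 hR' (pre ++ [A]) (D :: post) (by simp [h'])
      have hle := hH.slope_le pre (A ∪ D) post A h subset_union_left hneA
        (by simpa using hr)
      rw [empty_union] at hle
      rcases hle.lt_or_eq with h1 | h1
      exacts [Or.inl h1, Or.inr ⟨h1, pre, post, A, D, h, h'⟩]
    · have hneA := R.nonempty A (by simp [h])
      have hneD := R.nonempty D (by simp [h])
      have hd := R.disjoint
      rw [h] at hd
      have hdC := disjoint_unionOf hd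
      have hdD : Disjoint (unionOf (pre ++ [A])) D := by
        refine disjoint_unionOf (post := post) ?_
        simpa using hd
      simp only [unionOf_append, unionOf_cons, unionOf_nil, union_empty] at hdD
      have hdD' := disjoint_union_left.1 hdD
      have hne : A ≠ A ∪ D := fun he => by
        obtain ⟨x, hx⟩ := hneD
        exact disjoint_left.1 hdD'.2 (he ▸ mem_union_right _ hx) hx
      rw [penalizesLess_iff hC1 h h' hne]
      left
      rw [← chordSlope_lt_iff hφ Q hdC hneA hneD hdD'.1 hdD'.2]
      simpa using hH.slope_lt pre A D post h

theorem existsUnique_isPathConnectedFRanking (hconn : net.Connected) {f : ℕ → ℕ → ℝ}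
    (hpos : ∀ m n, 0 < n → 0 < f m n) (hC1 : CondC1 f) (hratio : CondRatio net f)
    {Q : Fin N → ℝ} (hQ : ∀ i, 0 ≤ Q i) :
    ∃! R : RankOrdering N, R.IsPathConnectedFRanking net f Q := by
  have hφ := isGrowth_growthOf hpos hC1 hratio
  obtain ⟨l, hl⟩ := exists_isHull hφ hQ hconn Network.rooted_empty
  refine ⟨⟨l, hl.nonempty, hl.disjoint, fun i => mem_unionOf.1 ?_⟩, ?_, ?_⟩
  · rw [← empty_union (unionOf l), hl.cover]
    exact mem_univ i
  · exact (isPathConnectedFRanking_iff hpos hC1 hratio Q).2 hl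
  · intro R hR
    exact ext_classes (((isPathConnectedFRanking_iff hpos hC1 hratio Q).1 hR).unique hφ hQ hl)

theorem _root_.Routing.IsORCDRanking.isRefinement (hconn : net.Connected) {f : ℕ → ℕ → ℝ}
    (hpos : ∀ m n, 0 < n → 0 < f m n) (hC1 : CondC1 f) (hratio : CondRatio net f)
    {Q : Fin N → ℝ} (hQ : ∀ i, 0 ≤ Q i) {R R' : RankOrdering N}
    (hR : R.IsPathConnectedFRanking net f Q) (hR' : IsORCDRanking net Q R') :
    R'.IsRefinement R := by
  intro a b hab
  cases b with
  | none => exact absurd hab (Nat.not_lt_zero _)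
  | some b =>
    cases a with
    | none => exact Nat.succ_pos _
    | some a =>
      obtain ⟨V, hV, hlt⟩ := hR'
      refine hlt _ _ ?_
      have hH := (isPathConnectedFRanking_iff hpos hC1 hratio Q).1 hR
      obtain ⟨D, hD, ha⟩ := R.cover a
      set k := R.classes.findIdx (fun C => decide (a ∈ C)) with hk
      have hlen : k < R.classes.length := List.findIdx_lt_length.2 ⟨D, hD, by simpa using ha⟩
      have hrank : R.rank (some a) = k + 1 := rfl
      have hsplit : R.classes = R.classes.take k ++ R.classes[k] :: R.classes.drop (k + 1) := by
        rw [List.getElem_cons_drop, List.take_append_drop]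
      have hbelow : R.below (k + 1) = unionOf (R.classes.take k) ∪ R.classes[k] := by
        rw [below_eq, List.take_succ_eq_append_getElem hlen, unionOf_append, unionOf_cons,
          unionOf_nil, union_empty]
      rw [hsplit] at hH
      refine hH.congestionCost_lt (isGrowth_growthOf hpos hC1 hratio) hQ hconn hV ?_ ?_
      · rw [some_mem_insertNone, ← hbelow, ← rank_le_iff, hrank]
      · rw [← hbelow, ← rank_le_iff]
        have : R.rank (some a) < R.rank (some b) := hab
        omega

/-- Every cost function orders the nodes. -/
theorem exists_of_cost (V : Fin N → ℝ) :
    ∃ R : RankOrdering N, ∀ i j, V i < V j → R.lt (some i) (some j) := by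
  classical
  set l := (List.finRange N).mergeSort (fun i j => decide (V i ≤ V j)) with hl
  have hperm : l.Perm (List.finRange N) := List.mergeSort_perm _ _
  have hnd : l.Nodup := hperm.nodup_iff.2 (List.nodup_finRange N)
  have hmem : ∀ i, i ∈ l := fun i => hperm.mem_iff.2 (List.mem_finRange i)
  have hsort : l.Pairwise fun i j => V i ≤ V j := by
    have := List.pairwise_mergeSort (le := fun i j => decide (V i ≤ V j))
      (by simpa using fun a b c => le_trans) (by simpa using fun a b => le_total _ _)
      (List.finRange N)
    simpa using this
  let R : RankOrdering N :=
    { classes := l.map fun i => {i}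
      nonempty := by simp
      disjoint := by
        rw [List.pairwise_map]
        exact hnd.imp fun h => by simpa using h
      cover := fun i => ⟨{i}, by simp [hmem i], by simp⟩ }
  have hrank : ∀ i, R.rank (some i) = l.idxOf i + 1 := by
    intro i
    show (l.map fun i => ({i} : Finset (Fin N))).findIdx _ + 1 = _
    rw [List.findIdx_map, List.idxOf]
    congr 2
    ext j
    by_cases hji : j = i
    · simp [hji]
    · simp [hji, Ne.symm hji]
  refine ⟨R, fun i j hij => ?_⟩
  show R.rank _ < R.rank _
  rw [hrank, hrank]
  have hi := List.idxOf_lt_length_iff.2 (hmem i)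
  have hj := List.idxOf_lt_length_iff.2 (hmem j)
  by_contra! hle
  rcases (Nat.le_of_succ_le_succ hle).eq_or_lt with h | h
  · have : i = j := by
      rw [← List.getElem_idxOf hi, ← List.getElem_idxOf hj]
      simp [h]
    subst this
    exact lt_irrefl _ hij
  · have := List.pairwise_iff_getElem.1 hsort _ _ hj hi h
    rw [List.getElem_idxOf, List.getElem_idxOf] at this
    exact absurd hij (not_lt.2 this)

end RankOrdering

theorem exists_isORCDRanking (hconn : net.Connected) {Q : Fin N → ℝ} (hQ : ∀ i, 0 ≤ Q i) :
    ∃ R, IsORCDRanking net Q R := by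
  obtain ⟨V, hV⟩ := exists_isCongestionCost hconn hQ
  obtain ⟨R, hR⟩ := RankOrdering.exists_of_cost fun i => V (some i)
  refine ⟨R, V, hV, fun i j hij => ?_⟩
  cases j with
  | none =>
    rw [hV.1.1] at hij
    exact absurd hij (not_lt.2 (hV.nonneg hconn hQ i))
  | some j =>
    cases i with
    | none => exact Nat.succ_pos _
    | some i => exact hR i j hij

/-- Some policy uses given rankings. -/
theorem exists_isPriorityBased (R : RankProcess N) : ∃ pol, IsPriorityBased pol R := by
  classical
  have hchoice : ∀ (H : List (Slot N)) (Q : Backlog N) (T : Finset (Node N)),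
      ∃ j : Node N, T.Nonempty → j ∈ T ∧ ∀ k ∈ T, (R H Q).le j k := by
    intro H Q T
    by_cases hT : T.Nonempty
    · obtain ⟨j, hj, hmin⟩ := Finset.exists_min_image T (R H Q).rank hT
      exact ⟨j, fun _ => ⟨hj, hmin⟩⟩
    · exact ⟨none, fun h => absurd h hT⟩
  choose best hbest using hchoice
  -- A policy must be valid for all `S`, including empty receptions that never occur; no packet
  -- moves then.
  refine ⟨⟨fun H Q S i j => if (S i).Nonempty ∧ j = best H Q (S i) then 1 else 0, ?_⟩, ?_⟩
  · intro H Q S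
    refine ⟨fun i j => ?_, fun i => ?_, fun i hi => ?_⟩
    · split_ifs with h1 h2 h2
      · exact le_rfl
      · exact absurd (h1.2 ▸ (hbest H Q _ h1.1).1) h2
      · exact zero_le_one
      · exact le_rfl
    · by_cases h : (S i).Nonempty <;> simp [h]
    · have hne : (S i).Nonempty := ⟨_, hi⟩
      -- Only the destination has rank 0, so it is chosen whenever it receives the packet.
      have hle := (hbest H Q _ hne).2 none hi
      have : best H Q (S i) = none := by
        cases hb : best H Q (S i) with
        | none => rfl
        | some b => rw [hb] at hle; exact absurd hle (Nat.not_succ_le_zero _)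
      simp [hne, this]
  · intro H Q S hS i
    have hne : (S i).Nonempty := ⟨_, hS i⟩
    refine ⟨best H Q (S i), (hbest H Q _ hne).1, (hbest H Q _ hne).2, ?_⟩
    simp [hne]

theorem exists_isORCDPolicy (hconn : net.Connected) :
    ∃ (pol : RoutingPolicy N) (R : RankProcess N), IsORCDPolicy net pol R := by
  choose R hR using fun Q : Backlog N =>
    exists_isORCDRanking hconn (Q := fun i => (Q i : ℝ)) fun i => Nat.cast_nonneg _
  obtain ⟨pol, hpol⟩ := exists_isPriorityBased fun _ Q => R Q
  exact ⟨pol, fun _ Q => R Q, hpol, fun _ Q => hR Q⟩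

end Routing

/-! ### Level sets, the Lyapunov function and its drift under ORCD -/

namespace Routing

open Finset

variable {N : ℕ} {net : Network N}

/-! ### Level sets of a backlog vector -/

/-- The function minimized by the level sets. -/
noncomputable def levelCost (φ : ℕ → ℝ) (Q : Fin N → ℝ) (s : ℝ) (A : Finset (Fin N)) : ℝ :=
  ∑ i ∈ A, Q i - s * φ A.card

/-- `A` is the largest rooted set that minimizes `Q_A - s φ(|A|)`. -/
structure IsLevel (net : Network N) (φ : ℕ → ℝ) (Q : Fin N → ℝ) (s : ℝ)
    (A : Finset (Fin N)) : Prop where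
  rooted : net.Rooted A
  le : ∀ B, net.Rooted B → levelCost φ Q s A ≤ levelCost φ Q s B
  subset : ∀ B, net.Rooted B → levelCost φ Q s B ≤ levelCost φ Q s A → B ⊆ A

section Level

variable {φ : ℕ → ℝ} {Q Q' : Fin N → ℝ} {s s' : ℝ} {A A' : Finset (Fin N)}

theorem levelCost_empty {p : ℝ} (hφ : IsGrowth p φ) : levelCost φ Q s ∅ = 0 := by
  simp [levelCost, hφ.zero]

/-- For incomparable `B`, `C` the cost of `C ∪ B` is at most the sum of their costs, by
`IsGrowth.add_le` at base 0. The minimum is at most 0, with `∅` as competitor, so minimizers are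
closed under union. -/
theorem exists_isLevel (hφ : IsGrowth net.pMin φ) (hQ : ∀ i, 0 ≤ Q i) (hs : 0 ≤ s) :
    ∃ A, IsLevel net φ Q s A := by
  classical
  obtain ⟨C₀, hC₀, hmin⟩ := exists_min_image (univ.filter net.Rooted) (levelCost φ Q s)
    ⟨∅, by simp [Network.rooted_empty]⟩
  obtain ⟨C, hC, hmax⟩ := exists_max_image ((univ.filter net.Rooted).filter fun A =>
    levelCost φ Q s A = levelCost φ Q s C₀) card ⟨C₀, by simpa using hC₀⟩
  simp only [mem_filter, mem_univ, true_and] at hC hmax hmin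
  have hle : ∀ B, net.Rooted B → levelCost φ Q s C ≤ levelCost φ Q s B := fun B hB =>
    hC.2.le.trans (hmin B hB)
  refine ⟨C, hC.1, hle, fun B hB hBC => ?_⟩
  by_contra hsub
  obtain ⟨x, hx, hxC⟩ := not_subset.1 hsub
  have hcardC : C.card < (C ∪ B).card :=
    card_lt_card ((ssubset_iff_of_subset subset_union_left).2 ⟨x, mem_union_right _ hx, hxC⟩)
  have hU := hC.1.union hB
  have hUC : levelCost φ Q s (C ∪ B) ≤ levelCost φ Q s C := by
    by_cases hCB : C ⊆ B
    · rwa [union_eq_right.2 hCB]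
    · obtain ⟨y, hy, hyB⟩ := not_subset.1 hCB
      have hcardB : B.card < (C ∪ B).card :=
        card_lt_card ((ssubset_iff_of_subset subset_union_right).2
          ⟨y, mem_union_left _ hy, hyB⟩)
      have h1 : levelCost φ Q s C ≤ 0 := (hle ∅ Network.rooted_empty).trans
        (levelCost_empty hφ).le
      have h2 : ∑ i ∈ C ∪ B, Q i ≤ ∑ i ∈ C, Q i + ∑ i ∈ B, Q i := by
        rw [← sum_union_inter]
        exact le_add_of_nonneg_right (sum_nonneg fun i _ => hQ i)
      have h3 := mul_le_mul_of_nonneg_left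
        (hφ.add_le (Nat.zero_le _) (Nat.zero_le _) hcardC hcardB) hs
      rw [hφ.zero] at h3
      unfold levelCost at h1 hBC ⊢
      linarith
  have := hmax (C ∪ B) ⟨hU, le_antisymm (hUC.trans hC.2.le) (hmin _ hU)⟩
  omega

theorem IsLevel.sum_le {p : ℝ} (hφ : IsGrowth p φ) (h : IsLevel net φ Q s A) :
    ∑ i ∈ A, Q i ≤ s * φ A.card := by
  have := h.le ∅ Network.rooted_empty
  rw [levelCost_empty hφ] at this
  exact sub_nonpos.1 this

/-- Strict because `A` is the largest minimizer. Together with `IsLevel.sum_le` it gives the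
hypotheses of `IsCongestionCost.lt_of_mem_of_notMem`; strictness also makes the queue of `k`
non-empty when `s = 0`. -/
theorem IsLevel.lt_of_rooted_insert (h : IsLevel net φ Q s A) {k : Fin N} (hk : k ∉ A)
    (hr : net.Rooted (insert k A)) : s * (φ (A.card + 1) - φ A.card) < Q k := by
  by_contra! hle
  refine hk (h.subset _ hr ?_ (mem_insert_self k A))
  rw [levelCost, levelCost, sum_insert hk, card_insert_of_notMem hk]
  linarith

/-- Level sets change slowly with the backlog. -/
theorem IsLevel.subset_of_le (hφ : IsGrowth net.pMin φ) (hgap : ∀ m n, m < n → φ m + 1 ≤ φ n)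
    (hQ : ∀ i, 0 ≤ Q i) (hs : 0 ≤ s) (h : IsLevel net φ Q s A) (h' : IsLevel net φ Q' s' A')
    {D : ℝ} (hD : 0 ≤ D) (hQ' : ∀ i, Q' i ≤ Q i + D) (hs' : s + N * D ≤ s') : A ⊆ A' := by
  by_contra hsub
  refine hsub (subset_union_right.trans
    (h'.subset (A' ∪ A) (h'.rooted.union h.rooted) ?_))
  have hE : (A \ A').Nonempty := sdiff_nonempty.2 hsub
  have hcard : A'.card < (A' ∪ A).card := by
    obtain ⟨x, hx, hxA⟩ := not_subset.1 hsub
    exact card_lt_card ((ssubset_iff_of_subset subset_union_left).2 ⟨x, mem_union_right _ hx, hxA⟩)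
  have hstep := hgap _ _ hcard
  -- Same dichotomy as for hulls: compare with `A'` if it lies in `A`; otherwise the growth of `φ`
  -- pays for all of `Q_A`.
  have h1 : ∑ i ∈ A \ A', Q i ≤ s * (φ (A' ∪ A).card - φ A'.card) := by
    by_cases hA : A' ⊆ A
    · have h2 := h.le A' h'.rooted
      have h3 := sum_sdiff (f := Q) hA
      rw [union_eq_right.2 hA]
      unfold levelCost at h2
      linarith
    · obtain ⟨y, hy, hyA⟩ := not_subset.1 hA
      have hcard' : A.card < (A' ∪ A).card :=
        card_lt_card ((ssubset_iff_of_subset subset_union_right).2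
          ⟨y, mem_union_left _ hy, hyA⟩)
      have h2 := mul_le_mul_of_nonneg_left
        (hφ.add_le (Nat.zero_le _) (Nat.zero_le _) hcard hcard') hs
      rw [hφ.zero] at h2
      have h3 : ∑ i ∈ A \ A', Q i ≤ ∑ i ∈ A, Q i :=
        sum_le_sum_of_subset_of_nonneg sdiff_subset fun i _ _ => hQ i
      have h4 := h.sum_le hφ
      linarith
  have h2 : ∑ i ∈ A \ A', Q' i ≤ ∑ i ∈ A \ A', Q i + N * D := by
    calc ∑ i ∈ A \ A', Q' i ≤ ∑ i ∈ A \ A', (Q i + D) := sum_le_sum fun i _ => hQ' i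
      _ = ∑ i ∈ A \ A', Q i + (A \ A').card * D := by
        rw [sum_add_distrib, sum_const, nsmul_eq_mul]
      _ ≤ _ := by
        have : ((A \ A').card : ℝ) ≤ N := by
          exact_mod_cast (card_le_univ (A \ A')).trans_eq (Fintype.card_fin N)
        have := mul_le_mul_of_nonneg_right this hD
        linarith
  have h3 : ∑ i ∈ A' ∪ A, Q' i = ∑ i ∈ A', Q' i + ∑ i ∈ A \ A', Q' i := by
    rw [← sum_union disjoint_sdiff, union_sdiff_self_eq_union]
  have hND : 0 ≤ N * D := mul_nonneg (Nat.cast_nonneg N) hD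
  have h4 : (s + N * D) * (φ (A' ∪ A).card - φ A'.card) ≤
      s' * (φ (A' ∪ A).card - φ A'.card) :=
    mul_le_mul_of_nonneg_right hs' (by linarith)
  -- The extra slope `N * D` pays for the at most `N * D` additional packets, as `φ` grows by at
  -- least 1 between the two cardinalities.
  have h5 : N * D * 1 ≤ N * D * (φ (A' ∪ A).card - φ A'.card) :=
    mul_le_mul_of_nonneg_left (by linarith) hND
  rw [levelCost, levelCost, h3]
  linarith

theorem IsLevel.eq_univ (hconn : net.Connected) (hgap : ∀ m n, m < n → φ m + 1 ≤ φ n)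
    (hQ : ∀ i, 0 ≤ Q i) (h : IsLevel net φ Q s A) (hs : ∑ i, Q i ≤ s) : A = univ := by
  by_contra hne
  refine hne (univ_subset_iff.1 (h.subset univ hconn.rooted_univ ?_))
  have hcard : A.card < (univ : Finset (Fin N)).card :=
    card_lt_card ((ssubset_univ_iff).2 hne)
  have h1 := hgap _ _ hcard
  have h2 : 0 ≤ ∑ i ∈ A, Q i := sum_nonneg fun i _ => hQ i
  have hs0 : 0 ≤ s := (sum_nonneg fun i _ => hQ i).trans hs
  have h3 : s * 1 ≤ s * (φ (univ : Finset (Fin N)).card - φ A.card) :=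
    mul_le_mul_of_nonneg_left (by linarith) hs0
  rw [levelCost, levelCost]
  linarith

end Level

/-! ### The Lyapunov function -/

/-- The real vector of backlogs. -/
abbrev realBacklog (Q : Backlog N) : Fin N → ℝ := fun i => (Q i : ℝ)

/-- The level set with slope `s`. -/
noncomputable def level (net : Network N) (φ : ℕ → ℝ) (Q : Backlog N) (s : ℕ) :
    Finset (Fin N) :=
  Classical.epsilon (IsLevel net φ (realBacklog Q) s)

/-- The number of level sets that do not contain `k`. -/
noncomputable def height (net : Network N) (φ : ℕ → ℝ) (Q : Backlog N) (k : Fin N) : ℕ :=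
  ((range (∑ i, Q i)).filter fun s => k ∉ level net φ Q s).card

/-- The piecewise quadratic Lyapunov function, with gradient `height`. -/
noncomputable def lyapunov (net : Network N) (φ : ℕ → ℝ) (Q : Backlog N) : ℝ :=
  ∑ s ∈ range (∑ i, Q i), (levelCost φ (realBacklog Q) s univ -
    levelCost φ (realBacklog Q) s (level net φ Q s))

section Lyapunov

variable {φ : ℕ → ℝ}

theorem isLevel_level (hφ : IsGrowth net.pMin φ) (Q : Backlog N) (s : ℕ) :
    IsLevel net φ (realBacklog Q) s (level net φ Q s) :=
  Classical.epsilon_spec (exists_isLevel hφ (fun _ => Nat.cast_nonneg _) (Nat.cast_nonneg s))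

theorem level_eq_univ (hφ : IsGrowth net.pMin φ) (hgap : ∀ m n, m < n → φ m + 1 ≤ φ n)
    (hconn : net.Connected) {Q : Backlog N} {s : ℕ} (hs : ∑ i, Q i ≤ s) :
    level net φ Q s = univ :=
  (isLevel_level hφ Q s).eq_univ hconn hgap (fun i => Nat.cast_nonneg _) (by exact_mod_cast hs)

/-- From slope `∑ Q` on, every level set is everything and contributes nothing. Two backlogs can
thus be compared over a common range of slopes. -/
theorem height_eq (hφ : IsGrowth net.pMin φ) (hgap : ∀ m n, m < n → φ m + 1 ≤ φ n)
    (hconn : net.Connected) {Q : Backlog N} {T : ℕ} (hT : ∑ i, Q i ≤ T) (k : Fin N) :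
    height net φ Q k = ((range T).filter fun s => k ∉ level net φ Q s).card := by
  unfold height
  congr 1
  ext s
  simp only [mem_filter, mem_range]
  refine ⟨fun h => ⟨h.1.trans_le hT, h.2⟩, fun h => ⟨?_, h.2⟩⟩
  by_contra! hs
  exact h.2 (by rw [level_eq_univ hφ hgap hconn hs]; exact mem_univ k)

theorem lyapunov_eq (hφ : IsGrowth net.pMin φ) (hgap : ∀ m n, m < n → φ m + 1 ≤ φ n)
    (hconn : net.Connected) {Q : Backlog N} {T : ℕ} (hT : ∑ i, Q i ≤ T) :
    lyapunov net φ Q = ∑ s ∈ range T, (levelCost φ (realBacklog Q) s univ -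
      levelCost φ (realBacklog Q) s (level net φ Q s)) := by
  refine sum_subset (range_subset_range.2 hT) fun s _ hs => ?_
  rw [level_eq_univ hφ hgap hconn (not_lt.1 fun h => hs (mem_range.2 h)), sub_self]

theorem lyapunov_nonneg (hφ : IsGrowth net.pMin φ) (hconn : net.Connected) (Q : Backlog N) :
    0 ≤ lyapunov net φ Q :=
  sum_nonneg fun s _ => sub_nonneg.2 ((isLevel_level hφ Q s).le univ hconn.rooted_univ)

theorem sum_level_compl (φ : ℕ → ℝ) (Q : Backlog N) (T : ℕ) (x : Fin N → ℝ) :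
    ∑ s ∈ range T, ∑ k ∈ (level net φ Q s)ᶜ, x k =
      ∑ k, (((range T).filter fun s => k ∉ level net φ Q s).card : ℝ) * x k := by
  have h1 : ∀ s, ∑ k ∈ (level net φ Q s)ᶜ, x k =
      ∑ k, if k ∉ level net φ Q s then x k else 0 := fun s => by
    rw [← sum_filter]
    refine sum_congr ?_ fun _ _ => rfl
    ext k
    simp
  simp only [h1]
  rw [sum_comm]
  refine sum_congr rfl fun k _ => ?_
  rw [← sum_filter, sum_const, nsmul_eq_mul]

/-- Subgradient inequality at `Q'`: each level set of `Q'` competes in the minimization for `Q`, and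
the `φ` terms cancel. -/
theorem lyapunov_sub_le (hφ : IsGrowth net.pMin φ) (hgap : ∀ m n, m < n → φ m + 1 ≤ φ n)
    (hconn : net.Connected) (Q Q' : Backlog N) :
    lyapunov net φ Q' - lyapunov net φ Q ≤
      ∑ k, (height net φ Q' k : ℝ) * ((Q' k : ℝ) - Q k) := by
  have hT : ∑ i, Q i ≤ ∑ i, Q i + ∑ i, Q' i := Nat.le_add_right _ _
  have hT' : ∑ i, Q' i ≤ ∑ i, Q i + ∑ i, Q' i := Nat.le_add_left _ _
  rw [lyapunov_eq hφ hgap hconn hT, lyapunov_eq hφ hgap hconn hT', ← sum_sub_distrib]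
  simp only [height_eq hφ hgap hconn hT']
  rw [← sum_level_compl]
  refine sum_le_sum fun s _ => ?_
  have h1 := (isLevel_level hφ Q s).le _ (isLevel_level hφ Q' s).rooted
  have h2 := sum_add_sum_compl (level net φ Q' s) (realBacklog Q)
  have h3 := sum_add_sum_compl (level net φ Q' s) (realBacklog Q')
  rw [sum_sub_distrib]
  unfold levelCost at h1 ⊢
  linarith

/-- The level set of `Q` at slope `s - N * D` lies in that of `Q'` at slope `s`. So the levels
missing `k` are, up to this shift, levels missing it for `Q`, apart from the first `N * D` ones. -/
theorem height_le_add (hφ : IsGrowth net.pMin φ) (hgap : ∀ m n, m < n → φ m + 1 ≤ φ n)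
    (hconn : net.Connected) {Q Q' : Backlog N} {D : ℕ} (h : ∀ i, Q' i ≤ Q i + D) (k : Fin N) :
    height net φ Q' k ≤ height net φ Q k + N * D := by
  set T := ∑ i, Q i + ∑ i, Q' i with hTdef
  have hT : ∑ i, Q i ≤ T := Nat.le_add_right _ _
  have hT' : ∑ i, Q' i ≤ T + N * D := (Nat.le_add_left _ _).trans (Nat.le_add_right _ _)
  rw [height_eq hφ hgap hconn hT, height_eq hφ hgap hconn hT']
  have hsub : ((range (T + N * D)).filter fun s => k ∉ level net φ Q' s) ⊆
      range (N * D) ∪ ((range T).filter fun s => k ∉ level net φ Q s).image (· + N * D) := by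
    intro s hs
    rw [mem_filter, mem_range] at hs
    rw [mem_union, mem_range, mem_image]
    by_cases hlt : s < N * D
    · exact Or.inl hlt
    · refine Or.inr ⟨s - N * D, ?_, by omega⟩
      rw [mem_filter, mem_range]
      refine ⟨by omega, fun hk => hs.2 ?_⟩
      refine (isLevel_level hφ Q (s - N * D)).subset_of_le hφ hgap (fun i => Nat.cast_nonneg _)
        (Nat.cast_nonneg _) (isLevel_level hφ Q' s) (D := D) (Nat.cast_nonneg _)
        (fun i => by exact_mod_cast h i) ?_ hk
      have : s - N * D + N * D ≤ s := by omega
      exact_mod_cast this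
  refine (card_le_card hsub).trans ((card_union_le _ _).trans ?_)
  rw [card_range, add_comm]
  exact Nat.add_le_add_right card_image_le _

/-- The Lyapunov function is convex with Lipschitz gradient. -/
theorem lyapunov_le (hφ : IsGrowth net.pMin φ) (hgap : ∀ m n, m < n → φ m + 1 ≤ φ n)
    (hconn : net.Connected) {Q Q' : Backlog N} {D : ℕ} (h : ∀ i, Q' i ≤ Q i + D)
    (h' : ∀ i, Q i ≤ Q' i + D) :
    lyapunov net φ Q' ≤ lyapunov net φ Q +
      ∑ s ∈ range (∑ i, Q i), ∑ k ∈ (level net φ Q s)ᶜ, ((Q' k : ℝ) - Q k) + N * (N * D * D) := by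
  have h1 := lyapunov_sub_le hφ hgap hconn Q Q'
  rw [sum_level_compl]
  have h2 : ∑ k, (height net φ Q' k : ℝ) * ((Q' k : ℝ) - Q k) ≤
      ∑ k, ((height net φ Q k : ℝ) * ((Q' k : ℝ) - Q k) + N * D * D) := by
    refine sum_le_sum fun k _ => ?_
    have e1 : (height net φ Q' k : ℝ) ≤ height net φ Q k + N * D := by
      exact_mod_cast height_le_add hφ hgap hconn h k
    have e2 : (height net φ Q k : ℝ) ≤ height net φ Q' k + N * D := by
      exact_mod_cast height_le_add hφ hgap hconn h' k
    have e3 : (Q' k : ℝ) ≤ Q k + D := by exact_mod_cast h k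
    have e4 : (Q k : ℝ) ≤ Q' k + D := by exact_mod_cast h' k
    -- The cost of moving the gradient from `Q'` to `Q`: the height changes by at most `N * D` and
    -- the backlog by at most `D`.
    have e5 : |((height net φ Q' k : ℝ) - height net φ Q k) * ((Q' k : ℝ) - Q k)| ≤
        N * D * D := by
      rw [abs_mul]
      exact mul_le_mul (abs_sub_le_iff.2 ⟨by linarith, by linarith⟩)
        (abs_sub_le_iff.2 ⟨by linarith, by linarith⟩) (abs_nonneg _) (by positivity)
    linarith [le_abs_self (((height net φ Q' k : ℝ) - height net φ Q k) * ((Q' k : ℝ) - Q k))]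
  rw [sum_add_distrib, sum_const, card_univ, Fintype.card_fin, nsmul_eq_mul] at h2
  unfold height at h2 h1
  linarith

/-- Some level `s ≤ height` contains `k`, as otherwise `height + 1` levels would miss it; there `Q
k` is at most the backlog of the level set, hence at most `s φ(N)`. -/
theorem backlog_le_height (hφ : IsGrowth net.pMin φ) (hgap : ∀ m n, m < n → φ m + 1 ≤ φ n)
    (hconn : net.Connected) (Q : Backlog N) (k : Fin N) :
    (Q k : ℝ) ≤ height net φ Q k * φ N := by
  obtain ⟨s, hs, hk⟩ : ∃ s ≤ height net φ Q k, k ∈ level net φ Q s := by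
    by_contra! hall
    have hT : ∑ i, Q i ≤ ∑ i, Q i + (height net φ Q k + 1) := Nat.le_add_right _ _
    have h1 := height_eq hφ hgap hconn hT k
    have h2 : range (height net φ Q k + 1) ⊆
        (range (∑ i, Q i + (height net φ Q k + 1))).filter fun s => k ∉ level net φ Q s := by
      intro s hs
      rw [mem_range] at hs
      rw [mem_filter, mem_range]
      exact ⟨by omega, hall s (by omega)⟩
    have h3 := card_le_card h2
    rw [card_range] at h3
    omega
  have h1 := (isLevel_level hφ Q s).sum_le hφ
  have h2 : (Q k : ℝ) ≤ ∑ i ∈ level net φ Q s, (Q i : ℝ) :=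
    single_le_sum (f := fun i => (Q i : ℝ)) (fun i _ => Nat.cast_nonneg _) hk
  have hmono := hφ.strictMono.monotone
  have h3 : φ (level net φ Q s).card ≤ φ N :=
    hmono ((card_le_univ _).trans_eq (Fintype.card_fin N))
  have h4 : 0 ≤ φ (level net φ Q s).card := hφ.zero ▸ hmono (Nat.zero_le _)
  calc (Q k : ℝ) ≤ s * φ (level net φ Q s).card := h2.trans h1
    _ ≤ _ := mul_le_mul (by exact_mod_cast hs) h3 h4 (Nat.cast_nonneg _)

end Lyapunov

/-- A geometric growth function. -/
theorem exists_isGrowth (net : Network N) :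
    ∃ φ, IsGrowth net.pMin φ ∧ ∀ m n, m < n → φ m + 1 ≤ φ n := by
  have hp := net.pMin_pos
  have hb1 : 1 ≤ 1 / net.pMin := (one_le_div hp).2 net.pMin_le_one
  -- With this base, `b ^ (n + 1) - b ^ n = b ^ n / p_min`: a single step exceeds `1 / p_min` times
  -- everything accumulated before it.
  set b : ℝ := 1 + 1 / net.pMin with hb
  have hb0 : 1 ≤ b := by linarith
  have hstep : ∀ n : ℕ, b ^ n + 1 ≤ b ^ (n + 1) := fun n => by
    have h1 : 1 ≤ b ^ n := one_le_pow₀ hb0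
    have h2 : b ^ n * 1 ≤ b ^ n * (1 / net.pMin) := mul_le_mul_of_nonneg_left hb1 (by linarith)
    rw [pow_succ, hb, mul_add, mul_one, ← hb]
    linarith
  have hgap : ∀ m n : ℕ, m < n → (b ^ m - 1) + 1 ≤ b ^ n - 1 := fun m n hmn => by
    have := (hstep m).trans (pow_le_pow_right₀ hb0 hmn)
    linarith
  refine ⟨fun n => b ^ n - 1, ⟨by simp, ?_, ?_⟩, hgap⟩
  · intro m n hmn
    have := hgap m n hmn
    show b ^ m - 1 < b ^ n - 1
    linarith
  · intro m n₁ n₂ h₁ h₂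
    have h1 : b ^ (m + n₁ + 1) ≤ b ^ (m + n₁ + n₂) := pow_le_pow_right₀ hb0 (by omega)
    have h2 : b ^ (m + n₁ + 1) = b ^ (m + n₁) + b ^ (m + n₁) / net.pMin := by
      rw [pow_succ, hb]
      ring
    have h3 : 0 ≤ b ^ m / net.pMin := by positivity
    have h4 : (b ^ (m + n₁) - 1 - (b ^ m - 1)) / net.pMin =
        b ^ (m + n₁) / net.pMin - b ^ m / net.pMin := by ring
    show (b ^ (m + n₁) - 1 - (b ^ m - 1)) / net.pMin ≤ b ^ (m + n₁ + n₂) - 1 - (b ^ (m + n₁) - 1)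
    rw [h4]
    linarith

/-! ### The backlog of a set of nodes -/

/-- A packet received by the nodes of `S` can leave `U`. -/
def Leaves (U : Finset (Fin N)) (S : Finset (Node N)) : Prop := ∃ j ∈ insertNone Uᶜ, j ∈ S

open Classical in
/-- The number of nodes of `U` whose packet can leave `U`. -/
noncomputable def exits (U : Finset (Fin N)) (S : Reception N) : ℕ :=
  ∑ i ∈ U, if Leaves U (S (some i)) then 1 else 0

/-- The packets that actually move from `i` to `j`. -/
def flow (Q : Backlog N) (μ : Decision N) (i j : Node N) : ℕ :=
  if μ i j ≤ nodeBacklog Q i then μ i j else 0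

section Balance

variable {Q : Backlog N} {μ : Decision N} {S : Reception N} {A : Fin N → ℕ}

theorem flow_le (i j : Node N) : flow Q μ i j ≤ μ i j := by
  unfold flow
  split_ifs <;> omega

theorem flow_none (j : Node N) : flow Q μ none j = 0 := by
  unfold flow
  split_ifs with h
  · exact Nat.le_zero.1 h
  · rfl

theorem IsRoutingDecision.le_one (h : IsRoutingDecision S μ) (i j : Node N) : μ i j ≤ 1 :=
  (h.le_indicator i j).trans (by split_ifs <;> omega)

theorem flow_of_pos (h : IsRoutingDecision S μ) {i : Fin N} (hi : 0 < Q i) (j : Node N) :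
    flow Q μ (some i) j = μ (some i) j :=
  if_pos ((h.le_one _ _).trans hi)

theorem flow_of_eq_zero {i : Fin N} (hi : Q i = 0) (j : Node N) : flow Q μ (some i) j = 0 := by
  unfold flow
  split_ifs with h
  · exact Nat.le_zero.1 (h.trans_eq hi)
  · rfl

/-- At most one packet is sent, and none from an empty queue, so the truncated subtraction removes
exactly the flow. This yields an exact conservation law. -/
theorem sub_add_flow (h : IsRoutingDecision S μ) (i : Fin N) :
    Q i - ∑ j, μ (some i) j + ∑ j, flow Q μ (some i) j = Q i := by
  rcases (Q i).eq_zero_or_pos with hi | hi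
  · simp [flow_of_eq_zero hi, hi]
  · simp only [flow_of_pos h hi]
    have := h.sum_le_one (some i)
    omega

theorem nextBacklog_add_flow (h : IsRoutingDecision S μ) (i : Fin N) :
    nextBacklog Q μ A i + ∑ j, flow Q μ (some i) j =
      Q i + ∑ j : Fin N, flow Q μ (some j) (some i) + A i := by
  have h1 := sub_add_flow (Q := Q) h i
  have h2 : ∑ j, (if μ j (some i) ≤ nodeBacklog Q j then μ j (some i) else 0) =
      ∑ j : Fin N, flow Q μ (some j) (some i) := by
    change ∑ j, flow Q μ j (some i) = _
    rw [Fintype.sum_option, flow_none, zero_add]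
  unfold nextBacklog
  rw [h2]
  omega

theorem sum_nextBacklog (h : IsRoutingDecision S μ) (U : Finset (Fin N)) :
    ∑ i ∈ U, nextBacklog Q μ A i + ∑ i ∈ U, ∑ j ∈ insertNone Uᶜ, flow Q μ (some i) j =
      ∑ i ∈ U, Q i + ∑ i ∈ Uᶜ, ∑ j ∈ U, flow Q μ (some i) (some j) + ∑ i ∈ U, A i := by
  have h1 : ∀ i, ∑ j, flow Q μ (some i) j = ∑ j ∈ insertNone Uᶜ, flow Q μ (some i) j +
      ∑ j ∈ U, flow Q μ (some i) (some j) := fun i => by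
    rw [Fintype.sum_option, sum_insertNone, ← sum_add_sum_compl U]
    ring
  have h2 : ∑ i ∈ U, ∑ j : Fin N, flow Q μ (some j) (some i) =
      ∑ i ∈ U, ∑ j ∈ U, flow Q μ (some i) (some j) +
        ∑ i ∈ Uᶜ, ∑ j ∈ U, flow Q μ (some i) (some j) := by
    rw [sum_add_sum_compl U fun i => ∑ j ∈ U, flow Q μ (some i) (some j), sum_comm]
  have h3 := sum_congr (rfl : U = U) fun i _ => nextBacklog_add_flow (Q := Q) (A := A) h i
  simp only [h1, sum_add_distrib] at h3
  rw [h2] at h3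
  omega

/-- No policy moves more packets out of `U` than possible. -/
theorem le_sum_nextBacklog (h : IsRoutingDecision S μ) (U : Finset (Fin N)) :
    ∑ i ∈ U, Q i + ∑ i ∈ U, A i ≤ ∑ i ∈ U, nextBacklog Q μ A i + exits U S := by
  have h1 := sum_nextBacklog (Q := Q) (A := A) h U
  have h2 : ∑ i ∈ U, ∑ j ∈ insertNone Uᶜ, flow Q μ (some i) j ≤ exits U S := by
    refine sum_le_sum fun i _ => ?_
    have hle : ∑ j ∈ insertNone Uᶜ, flow Q μ (some i) j ≤ ∑ j ∈ insertNone Uᶜ, μ (some i) j :=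
      sum_le_sum fun j _ => flow_le _ _
    split_ifs with hl
    · exact hle.trans ((sum_le_sum_of_subset (subset_univ _)).trans (h.sum_le_one _))
    · refine hle.trans (sum_nonpos fun j hj => ?_)
      refine (h.le_indicator _ _).trans ?_
      rw [if_neg fun hjS => hl ⟨j, hj, hjS⟩]
  omega

/-- If all packets that can leave `U` do so and no packet enters `U`, its backlog decreases as
much as possible. -/
theorem sum_nextBacklog_le (h : IsRoutingDecision S μ) (U : Finset (Fin N))
    (hout : ∀ i ∈ U, Leaves U (S (some i)) →
      0 < Q i ∧ ∃ j ∈ insertNone Uᶜ, μ (some i) j = 1)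
    (hin : ∀ i ∉ U, ∀ j ∈ U, μ (some i) (some j) = 0) :
    ∑ i ∈ U, nextBacklog Q μ A i + exits U S ≤ ∑ i ∈ U, Q i + ∑ i ∈ U, A i := by
  have h1 := sum_nextBacklog (Q := Q) (A := A) h U
  have h2 : exits U S ≤ ∑ i ∈ U, ∑ j ∈ insertNone Uᶜ, flow Q μ (some i) j := by
    refine sum_le_sum fun i hi => ?_
    split_ifs with hl
    · obtain ⟨hq, j, hj, hμ⟩ := hout i hi hl
      rw [← hμ, ← flow_of_pos h hq]
      exact single_le_sum (f := fun j => flow Q μ (some i) j) (fun _ _ => Nat.zero_le _) hj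
    · exact Nat.zero_le _
  have h3 : ∑ i ∈ Uᶜ, ∑ j ∈ U, flow Q μ (some i) (some j) = 0 :=
    sum_eq_zero fun i hi => sum_eq_zero fun j hj =>
      Nat.le_zero.1 ((flow_le _ _).trans (hin i (mem_compl.1 hi) j hj).le)
  omega

theorem nextBacklog_le (h : IsRoutingDecision S μ) {a : ℕ} (hA : ∀ i, A i ≤ a) (i : Fin N) :
    nextBacklog Q μ A i ≤ Q i + (N + a + 1) := by
  have h1 := nextBacklog_add_flow (Q := Q) (A := A) h i
  have h2 : ∑ j : Fin N, flow Q μ (some j) (some i) ≤ ∑ j : Fin N, 1 :=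
    sum_le_sum fun j _ => (flow_le _ _).trans (h.le_one _ _)
  simp only [sum_const, card_univ, Fintype.card_fin, smul_eq_mul, mul_one] at h2
  have := hA i
  omega

theorem le_nextBacklog (h : IsRoutingDecision S μ) (a : ℕ) (i : Fin N) :
    Q i ≤ nextBacklog Q μ A i + (N + a + 1) := by
  have h1 := nextBacklog_add_flow (Q := Q) (A := A) h i
  have h2 : ∑ j, flow Q μ (some i) j ≤ ∑ j, μ (some i) j := sum_le_sum fun j _ => flow_le _ _
  have h3 := h.sum_le_one (some i)
  omega

end Balance

/-! ### ORCD empties the complements of level sets as fast as possible -/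

theorem IsRoutingDecision.eq_zero_of_ne {S : Reception N} {μ : Decision N}
    (h : IsRoutingDecision S μ) {i j k : Node N} (hj : μ i j = 1) (hkj : k ≠ j) : μ i k = 0 := by
  have h1 := h.sum_le_one i
  have h2 : ∑ x ∈ {k, j}, μ i x ≤ ∑ x, μ i x := sum_le_sum_of_subset (subset_univ _)
  rw [sum_pair hkj, hj] at h2
  omega

/-- Costs in `L ∪ {0}` are below those outside, so a packet received there is forwarded there. A
node of `L` receives its own packet, so nothing leaks out of `L`. A node outside that has such a
receiver can be added to `L`, so its queue is non-empty and a real packet leaves. -/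
theorem IsORCDPolicy.sum_nextBacklog_le {φ : ℕ → ℝ} (hφ : IsGrowth net.pMin φ)
    (hconn : net.Connected) {pol : RoutingPolicy N} {R : RankProcess N}
    (hpol : IsORCDPolicy net pol R) (H : List (Slot N)) (Q : Backlog N) {S : Reception N}
    (hS : ∀ i, S i ∈ (net.P i).support) (A : Fin N → ℕ) (s : ℕ) :
    ∑ i ∈ (level net φ Q s)ᶜ, nextBacklog Q (pol.decide H Q S) A i +
        exits (level net φ Q s)ᶜ S ≤
      ∑ i ∈ (level net φ Q s)ᶜ, Q i + ∑ i ∈ (level net φ Q s)ᶜ, A i := by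
  have hL := isLevel_level hφ Q s
  set L := level net φ Q s with hLdef
  obtain ⟨V, hV, hlt⟩ := hpol.2 H Q
  have hvalid := pol.valid H Q S
  have hVlt : ∀ {a : Node N}, a ∈ insertNone L → ∀ {b : Fin N}, b ∉ L → V a < V (some b) :=
    fun {a} ha {b} hb => hV.lt_of_mem_of_notMem hφ hconn (fun i => Nat.cast_nonneg _) hL.rooted
      (Nat.cast_nonneg s) (hL.sum_le hφ) (fun k hk hr => hL.lt_of_rooted_insert hk hr) ha hb
  have hpr := hpol.1 H Q S fun i => net.self_mem i _ (hS i)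
  have hchoice : ∀ i, (∃ j ∈ insertNone L, j ∈ S i) →
      ∃ j ∈ insertNone L, pol.decide H Q S i j = 1 := by
    rintro i ⟨j₀, hj₀, hj₀S⟩
    obtain ⟨j, -, hmin, hj⟩ := hpr i
    refine ⟨j, ?_, hj⟩
    cases j with
    | none => simp
    | some j =>
      rw [some_mem_insertNone]
      by_contra hjL
      exact absurd (hlt _ _ (hVlt hj₀ hjL)) (not_lt.2 (hmin j₀ hj₀S))
  refine Routing.sum_nextBacklog_le hvalid _ ?_ ?_
  · intro i hi hl
    rw [Leaves, compl_compl] at hl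
    refine ⟨?_, by rw [compl_compl]; exact hchoice _ hl⟩
    rw [mem_compl] at hi
    obtain ⟨j, hj, hjS⟩ := hl
    have hlink : net.Links L i := by
      refine ⟨j, hj, S (some i), hjS, ENNReal.toReal_pos ?_ ((net.P _).apply_ne_top _)⟩
      exact (PMF.mem_support_iff _ _).1 (hS (some i))
    have h1 := hL.lt_of_rooted_insert hi (hL.rooted.insert hlink)
    have h2 : 0 ≤ (s : ℝ) * (φ (L.card + 1) - φ L.card) :=
      mul_nonneg (Nat.cast_nonneg s) (sub_nonneg.2 (hφ.strictMono.monotone (Nat.le_succ _)))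
    exact_mod_cast h2.trans_lt h1
  · intro i hi j hj
    rw [mem_compl, not_not] at hi
    rw [mem_compl] at hj
    obtain ⟨k, hk, hμ⟩ := hchoice (some i)
      ⟨some i, some_mem_insertNone.2 hi, net.self_mem _ _ (hS _)⟩
    refine hvalid.eq_zero_of_ne hμ ?_
    rintro rfl
    exact hj (some_mem_insertNone.1 hk)

theorem IsORCDPolicy.lyapunov_drift {φ : ℕ → ℝ} (hφ : IsGrowth net.pMin φ)
    (hgap : ∀ m n, m < n → φ m + 1 ≤ φ n)
    (hconn : net.Connected) {pol : RoutingPolicy N} {R : RankProcess N}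
    (hpol : IsORCDPolicy net pol R) (H : List (Slot N)) (Q : Backlog N) {S : Reception N}
    (hS : ∀ i, S i ∈ (net.P i).support) {A : Fin N → ℕ} {a : ℕ} (hA : ∀ i, A i ≤ a) :
    lyapunov net φ (nextBacklog Q (pol.decide H Q S) A) +
        (∑ s ∈ range (∑ i, Q i), exits (level net φ Q s)ᶜ S : ℕ) ≤
      lyapunov net φ Q +
        (∑ s ∈ range (∑ i, Q i), ∑ i ∈ (level net φ Q s)ᶜ, A i : ℕ) +
        (N * (N * (N + a + 1) * (N + a + 1)) : ℕ) := by
  have h1 := lyapunov_le hφ hgap hconn (nextBacklog_le (Q := Q) (pol.valid H Q S) hA)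
    (le_nextBacklog (A := A) (pol.valid H Q S) a)
  have h2 : ∑ s ∈ range (∑ i, Q i), ∑ k ∈ (level net φ Q s)ᶜ,
        ((nextBacklog Q (pol.decide H Q S) A k : ℝ) - Q k) ≤
      ∑ s ∈ range (∑ i, Q i), ((∑ i ∈ (level net φ Q s)ᶜ, A i : ℕ) -
        (exits (level net φ Q s)ᶜ S : ℝ)) := by
    refine sum_le_sum fun s _ => ?_
    have h3 : ((∑ i ∈ (level net φ Q s)ᶜ, nextBacklog Q (pol.decide H Q S) A i +
        exits (level net φ Q s)ᶜ S : ℕ) : ℝ) ≤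
      (∑ i ∈ (level net φ Q s)ᶜ, Q i + ∑ i ∈ (level net φ Q s)ᶜ, A i : ℕ) :=
      Nat.cast_le.2 (hpol.sum_nextBacklog_le hφ hconn H Q hS A s)
    push_cast at h3 ⊢
    rw [sum_sub_distrib]
    linarith
  rw [sum_sub_distrib] at h2
  push_cast at h1 h2 ⊢
  linarith

end Routing

/-! ### Expectations, cut constraints and throughput optimality -/

namespace Routing

open Finset

variable {N : ℕ} {net : Network N}

/-! ### Expectations of discrete random elements -/

/-- Expectation of a non-negative function of a discrete random element. -/
noncomputable def mean {α : Type} (p : PMF α) (g : α → ℝ≥0∞) : ℝ≥0∞ := ∑' a, p a * g a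

section Mean

variable {α β : Type} (p : PMF α)

theorem mean_add (g h : α → ℝ≥0∞) : mean p (fun a => g a + h a) = mean p g + mean p h := by
  simp only [mean, mul_add, ENNReal.tsum_add]

theorem mean_const (c : ℝ≥0∞) : mean p (fun _ => c) = c := by
  rw [mean, ENNReal.tsum_mul_right, p.tsum_coe, one_mul]

theorem mean_mul_left (c : ℝ≥0∞) (g : α → ℝ≥0∞) : mean p (fun a => c * g a) = c * mean p g := by
  simp only [mean, mul_left_comm _ c, ENNReal.tsum_mul_left]

theorem mean_sum {ι : Type} (s : Finset ι) (g : ι → α → ℝ≥0∞) :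
    mean p (fun a => ∑ i ∈ s, g i a) = ∑ i ∈ s, mean p (g i) := by
  simp only [mean, Finset.mul_sum]
  exact Summable.tsum_finsetSum fun _ _ => ENNReal.summable

theorem mean_mono {g h : α → ℝ≥0∞} (hgh : ∀ a ∈ p.support, g a ≤ h a) : mean p g ≤ mean p h := by
  refine ENNReal.tsum_le_tsum fun a => ?_
  by_cases ha : a ∈ p.support
  · exact mul_le_mul_right (hgh a ha) _
  · rw [PMF.mem_support_iff, not_not] at ha
    simp [ha]

theorem mean_pure (a : α) (g : α → ℝ≥0∞) : mean (PMF.pure a) g = g a := by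
  rw [mean, tsum_eq_single a]
  · simp
  · intro b hb
    simp [hb]

theorem mean_bind (q : α → PMF β) (g : β → ℝ≥0∞) :
    mean (p.bind q) g = mean p fun a => mean (q a) g := by
  simp only [mean, PMF.bind_apply, ← ENNReal.tsum_mul_right, ← ENNReal.tsum_mul_left]
  rw [ENNReal.tsum_comm]
  simp only [mul_assoc]

theorem mean_map (q : α → β) (g : β → ℝ≥0∞) : mean (p.map q) g = mean p fun a => g (q a) := by
  rw [← PMF.bind_pure_comp, mean_bind]
  simp only [Function.comp_apply, mean_pure]

end Mean

/-! ### Arrival rates and capacities -/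

theorem Traffic.reception_mem (tr : Traffic net) {o : (Fin N → ℕ) × Reception N}
    (ho : o ∈ tr.law.support) (i : Node N) : o.2 i ∈ (net.P i).support := by
  rw [← tr.map_reception i, PMF.mem_support_map_iff]
  exact ⟨o, ho, rfl⟩

theorem Traffic.mean_arrival (tr : Traffic net) (i : Fin N) :
    mean tr.law (fun o => (o.1 i : ℝ≥0∞)) = ENNReal.ofReal (tr.rate i) := by
  obtain ⟨a, ha⟩ := tr.bounded
  have h1 : mean tr.law (fun o => (o.1 i : ℝ≥0∞)) ≤ a := by
    rw [← mean_const tr.law (a : ℝ≥0∞)]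
    exact mean_mono _ fun o ho => by exact_mod_cast ha o ho i
  exact (ENNReal.ofReal_toReal (h1.trans_lt (ENNReal.natCast_lt_top a)).ne).symm

theorem Traffic.rate_nonneg (tr : Traffic net) (i : Fin N) : 0 ≤ tr.rate i :=
  ENNReal.toReal_nonneg

theorem Traffic.mean_sum_arrival (tr : Traffic net) (U : Finset (Fin N)) :
    mean tr.law (fun o => ((∑ i ∈ U, o.1 i : ℕ) : ℝ≥0∞)) =
      ENNReal.ofReal (∑ i ∈ U, tr.rate i) := by
  simp only [Nat.cast_sum]
  rw [mean_sum, ENNReal.ofReal_sum_of_nonneg fun i _ => tr.rate_nonneg i]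
  exact sum_congr rfl fun i _ => tr.mean_arrival i

open Classical in
/-- The expected number of packets that can leave `U` in one slot. -/
noncomputable def capacity (net : Network N) (U : Finset (Fin N)) : ℝ≥0∞ :=
  ∑ i ∈ U, mean (net.P (some i)) fun S => if Leaves U S then 1 else 0

theorem capacity_ne_top (U : Finset (Fin N)) : capacity net U ≠ ⊤ := by
  classical
  refine (ENNReal.sum_lt_top.2 fun i _ => ?_).ne
  refine lt_of_le_of_lt (mean_mono (h := fun _ => 1) _ fun S _ => ?_) ?_
  · split_ifs <;> simp
  · rw [mean_const]
    exact ENNReal.one_lt_top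

theorem Traffic.mean_exits (tr : Traffic net) (U : Finset (Fin N)) :
    mean tr.law (fun o => (exits U o.2 : ℝ≥0∞)) = capacity net U := by
  classical
  simp only [exits, Nat.cast_sum]
  rw [mean_sum]
  refine sum_congr rfl fun i _ => ?_
  rw [← tr.map_reception (some i), mean_map]
  refine congrArg (mean tr.law) (funext fun o => ?_)
  split_ifs <;> simp

theorem mean_stateLaw_succ (tr : Traffic net) (pol : RoutingPolicy N) (q₀ : Backlog N) (t : ℕ)
    (g : Backlog N → ℝ≥0∞) :
    mean (stateLaw tr pol q₀ (t + 1)) (fun x => g x.2) =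
      mean (stateLaw tr pol q₀ t) fun x => mean tr.law fun o =>
        g (nextBacklog x.2 (pol.decide x.1 x.2 o.2) o.1) := by
  rw [stateLaw, mean_bind]
  simp only [mean_map]

/-! ### The cut bound -/

theorem mean_sum_backlog (tr : Traffic net) (pol : RoutingPolicy N) (q₀ : Backlog N) (t : ℕ)
    (U : Finset (Fin N)) :
    mean (stateLaw tr pol q₀ t) (fun x => ((∑ i ∈ U, x.2 i : ℕ) : ℝ≥0∞)) =
      ∑ i ∈ U, meanBacklog tr pol q₀ t i := by
  simp only [Nat.cast_sum]
  rw [mean_sum]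
  rfl

theorem mean_backlog_add_rate_le (tr : Traffic net) (pol : RoutingPolicy N) (q₀ : Backlog N)
    (U : Finset (Fin N)) (t : ℕ) :
    ∑ i ∈ U, meanBacklog tr pol q₀ t i + ENNReal.ofReal (∑ i ∈ U, tr.rate i) ≤
      ∑ i ∈ U, meanBacklog tr pol q₀ (t + 1) i + capacity net U := by
  rw [← mean_sum_backlog, ← mean_sum_backlog,
    mean_stateLaw_succ tr pol q₀ t fun Q => ((∑ i ∈ U, Q i : ℕ) : ℝ≥0∞),
    ← mean_const (stateLaw tr pol q₀ t) (ENNReal.ofReal (∑ i ∈ U, tr.rate i)),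
    ← mean_const (stateLaw tr pol q₀ t) (capacity net U), ← mean_add, ← mean_add]
  refine mean_mono _ fun x _ => ?_
  rw [← tr.mean_sum_arrival U, ← tr.mean_exits U, ← mean_add,
    ← mean_const tr.law ((∑ i ∈ U, x.2 i : ℕ) : ℝ≥0∞), ← mean_add]
  refine mean_mono _ fun o _ => ?_
  exact_mod_cast le_sum_nextBacklog (pol.valid x.1 x.2 o.2) U

/-- Rates in the stability region satisfy all cut constraints. -/
theorem Stabilizes.rate_le_capacity {tr : Traffic net} {pol : RoutingPolicy N}
    (h : Stabilizes tr pol) (U : Finset (Fin N)) :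
    ENNReal.ofReal (∑ i ∈ U, tr.rate i) ≤ capacity net U := by
  by_contra! hlt
  set m : ℕ → ℝ≥0∞ := fun t => ∑ i ∈ U, meanBacklog tr pol 0 t i with hm
  set η := ENNReal.ofReal (∑ i ∈ U, tr.rate i) - capacity net U with hη
  have hη0 : η ≠ 0 := (tsub_pos_of_lt hlt).ne'
  have hadd : η + capacity net U = ENNReal.ofReal (∑ i ∈ U, tr.rate i) :=
    tsub_add_cancel_of_le hlt.le
  have hstep : ∀ t, m t + η ≤ m (t + 1) := fun t => by
    have h1 := mean_backlog_add_rate_le tr pol 0 U t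
    rw [← hadd, ← add_assoc] at h1
    exact (ENNReal.add_le_add_iff_right (capacity_ne_top U)).1 h1
  have hgrow : ∀ t : ℕ, t * η ≤ m t := by
    intro t
    induction t with
    | zero => simp
    | succ t ih =>
      rw [Nat.cast_succ, add_mul, one_mul]
      exact (add_le_add_left ih η).trans (hstep t)
  have hbound : ∀ i, ∃ c : ℝ≥0∞, c < ⊤ ∧ ∀ᶠ T : ℕ in Filter.atTop,
      (∑ t ∈ range T, meanBacklog tr pol 0 t i) / (T : ℝ≥0∞) < c := fun i => by
    obtain ⟨c, hc1, hc2⟩ := exists_between (h 0 i)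
    exact ⟨c, hc2, Filter.eventually_lt_of_limsup_lt hc1⟩
  choose c hc hev using hbound
  set K := ∑ i ∈ U, c i with hK
  have hKtop : K ≠ ⊤ := (ENNReal.sum_lt_top.2 fun i _ => hc i).ne
  have hall : ∀ᶠ T : ℕ in Filter.atTop, ∑ t ∈ range T, m t ≤ K * T := by
    have h1 : ∀ᶠ T : ℕ in Filter.atTop, ∀ i,
        (∑ t ∈ range T, meanBacklog tr pol 0 t i) / (T : ℝ≥0∞) < c i :=
      Filter.eventually_all.2 hev
    filter_upwards [h1, Filter.eventually_gt_atTop 0] with T hT hT0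
    rw [hK, sum_mul, hm, sum_comm]
    refine sum_le_sum fun i _ => ?_
    exact (ENNReal.div_le_iff (by exact_mod_cast hT0.ne') (ENNReal.natCast_ne_top T)).1 (hT i).le
  obtain ⟨T₀, hT₀⟩ := Filter.eventually_atTop.1 hall
  obtain ⟨n₀, hn₀⟩ := ENNReal.exists_nat_mul_gt hη0 (ENNReal.mul_ne_top hKtop ENNReal.ofNat_ne_top :
    K * 2 ≠ ⊤)
  -- The mean backlog of `U` grows at least like `t η`. The second half of the window of length `2n`
  -- alone contributes `n² η`, while stability allows only `2nK`; this fails once `n η > 2K`.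
  set n := T₀ + n₀ + 1 with hn
  have h1 := hT₀ (n + n) (by omega)
  have h2 : (n : ℝ≥0∞) * (n * η) ≤ ∑ t ∈ range (n + n), m t := by
    calc (n : ℝ≥0∞) * (n * η) = ∑ x ∈ range n, (n : ℝ≥0∞) * η := by
          rw [sum_const, card_range, nsmul_eq_mul]
      _ ≤ ∑ x ∈ range n, m (n + x) := by
          refine sum_le_sum fun x _ => le_trans ?_ (hgrow (n + x))
          exact mul_le_mul_left (by exact_mod_cast Nat.le_add_right n x) η
      _ ≤ ∑ t ∈ range n, m t + ∑ x ∈ range n, m (n + x) := le_add_self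
      _ = _ := (sum_range_add m n n).symm
  have h3 : (n : ℝ≥0∞) * (n * η) ≤ n * (K * 2) := by
    refine (h2.trans h1).trans_eq ?_
    rw [Nat.cast_add]
    ring
  have hn0 : (n : ℝ≥0∞) ≠ 0 := by exact_mod_cast (by omega : n ≠ 0)
  have h4 : (n : ℝ≥0∞) * η ≤ K * 2 :=
    (ENNReal.mul_le_mul_iff_right hn0 (ENNReal.natCast_ne_top n)).1 h3
  have h5 : (n₀ : ℝ≥0∞) * η ≤ n * η :=
    mul_le_mul_left (by exact_mod_cast (by omega : n₀ ≤ n)) η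
  exact absurd (hn₀.trans_le (h5.trans h4)) (lt_irrefl _)

/-- Raise all rates by a small `ε` within the region and apply the cut bound to a traffic with these
rates; the capacities depend on the network only. -/
theorem exists_slack_of_mem_interior {lam : Fin N → ℝ}
    (h : lam ∈ interior (stabilityRegion net)) {tr : Traffic net} (hrate : tr.rate = lam) :
    ∃ ε > 0, ∀ U : Finset (Fin N),
      ENNReal.ofReal (∑ i ∈ U, tr.rate i) + ENNReal.ofReal ε * (U.card : ℝ≥0∞) ≤
        capacity net U := by
  have hcont : Filter.Tendsto (fun ε : ℝ => fun i => lam i + ε) (nhdsWithin 0 (Set.Ioi 0))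
      (nhds lam) := by
    have h1 : Continuous fun ε : ℝ => fun i => lam i + ε := by fun_prop
    have h2 := h1.tendsto 0
    simp only [add_zero] at h2
    exact h2.mono_left nhdsWithin_le_nhds
  obtain ⟨ε, hε, hε0⟩ := ((hcont.eventually (mem_interior_iff_mem_nhds.1 h)).and
    self_mem_nhdsWithin).exists
  obtain ⟨tr', hrate', pol, hstab⟩ := hε
  refine ⟨ε, hε0, fun U => ?_⟩
  have h1 := hstab.rate_le_capacity U
  have hε0' : (0 : ℝ) ≤ ε := le_of_lt hε0
  have h2 : ∑ i ∈ U, tr'.rate i = ∑ i ∈ U, tr.rate i + ε * U.card := by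
    rw [hrate', hrate, sum_add_distrib, sum_const, nsmul_eq_mul, mul_comm]
  rwa [h2, ENNReal.ofReal_add (sum_nonneg fun i _ => tr.rate_nonneg i) (by positivity),
    ENNReal.ofReal_mul hε0', ENNReal.ofReal_natCast] at h1

/-! ### Throughput optimality -/

/-- Foster–Lyapunov: the drift inequality is averaged over the state and telescoped over time. -/
theorem stabilizes_of_drift {tr : Traffic net} {pol : RoutingPolicy N}
    (L : Backlog N → ℝ≥0∞) (hL : ∀ Q, L Q ≠ ⊤) {C δ : ℝ≥0∞} (hC : C ≠ ⊤) (hδ : δ ≠ 0)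
    (hδ' : δ ≠ ⊤)
    (hdrift : ∀ H Q i, mean tr.law (fun o => L (nextBacklog Q (pol.decide H Q o.2) o.1)) +
      δ * (Q i : ℝ≥0∞) ≤ L Q + C) : Stabilizes tr pol := by
  intro q₀ i
  set M : ℕ → ℝ≥0∞ := fun t => mean (stateLaw tr pol q₀ t) fun x => L x.2 with hM
  have hstep : ∀ t, M (t + 1) + δ * meanBacklog tr pol q₀ t i ≤ M t + C := by
    intro t
    have h1 : meanBacklog tr pol q₀ t i =
      mean (stateLaw tr pol q₀ t) fun x => (x.2 i : ℝ≥0∞) := rfl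
    rw [hM, h1]
    simp only
    rw [mean_stateLaw_succ tr pol q₀ t L, ← mean_mul_left, ← mean_add,
      ← mean_const (stateLaw tr pol q₀ t) C, ← mean_add]
    exact mean_mono _ fun x _ => hdrift x.1 x.2 i
  have hsum : ∀ T : ℕ, M T + δ * ∑ t ∈ range T, meanBacklog tr pol q₀ t i ≤ L q₀ + C * T := by
    intro T
    induction T with
    | zero => simp [hM, stateLaw, mean_pure]
    | succ T ih =>
      rw [sum_range_succ, mul_add, Nat.cast_succ, mul_add, mul_one, ← add_assoc (L q₀)]
      calc M (T + 1) + (δ * ∑ t ∈ range T, meanBacklog tr pol q₀ t i +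
            δ * meanBacklog tr pol q₀ T i)
          = M (T + 1) + δ * meanBacklog tr pol q₀ T i +
            δ * ∑ t ∈ range T, meanBacklog tr pol q₀ t i := by ring
        _ ≤ M T + C + δ * ∑ t ∈ range T, meanBacklog tr pol q₀ t i :=
            add_le_add_left (hstep T) _
        _ = M T + δ * ∑ t ∈ range T, meanBacklog tr pol q₀ t i + C := by ring
        _ ≤ _ := add_le_add_left ih C
  refine lt_of_le_of_lt (Filter.limsup_le_of_le (a := (L q₀ + C) / δ) (by isBoundedDefault) ?_)
    (ENNReal.div_lt_top (ENNReal.add_ne_top.2 ⟨hL q₀, hC⟩) hδ)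
  filter_upwards [Filter.eventually_ge_atTop 1] with T hT
  have hT0 : (T : ℝ≥0∞) ≠ 0 := by exact_mod_cast (by omega : T ≠ 0)
  refine ENNReal.div_le_of_le_mul ?_
  have h1 : δ * ∑ t ∈ range T, meanBacklog tr pol q₀ t i ≤ (L q₀ + C) * T := by
    refine (le_add_self.trans (hsum T)).trans ?_
    rw [add_mul]
    refine add_le_add_left ?_ _
    exact le_mul_of_one_le_right zero_le (by exact_mod_cast hT)
  rw [ENNReal.mul_div_right_comm.symm, ENNReal.le_div_iff_mul_le (Or.inl hδ) (Or.inl hδ'), mul_comm]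
  exact h1

theorem IsORCDPolicy.throughputOptimal (hconn : net.Connected) {pol : RoutingPolicy N}
    {R : RankProcess N} (hpol : IsORCDPolicy net pol R) : ThroughputOptimal net pol := by
  intro lam hlam tr hrate
  obtain ⟨φ, hφ, hgap⟩ := exists_isGrowth net
  obtain ⟨ε, hε, hslack⟩ := exists_slack_of_mem_interior hlam hrate
  obtain ⟨a, ha⟩ := tr.bounded
  have hφN : 0 ≤ φ N := hφ.zero ▸ hφ.strictMono.monotone (Nat.zero_le N)
  -- `φ N` comes from `backlog_le_height`; the `+ 1` keeps the denominator positive even for `N =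
  -- 0`.
  have hδ : 0 < ε / (φ N + 1) := by positivity
  refine stabilizes_of_drift (fun Q => ENNReal.ofReal (lyapunov net φ Q))
    (fun Q => ENNReal.ofReal_ne_top) (C := (N * (N * (N + a + 1) * (N + a + 1)) : ℕ))
    (δ := ENNReal.ofReal (ε / (φ N + 1))) (ENNReal.natCast_ne_top _)
    (ENNReal.ofReal_pos.2 hδ).ne' ENNReal.ofReal_ne_top fun H Q i => ?_
  set C : ℕ := N * (N * (N + a + 1) * (N + a + 1)) with hC
  set T := ∑ i, Q i with hT
  set U : ℕ → Finset (Fin N) := fun s => (level net φ Q s)ᶜ with hU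
  have h1 : mean tr.law (fun o =>
        ENNReal.ofReal (lyapunov net φ (nextBacklog Q (pol.decide H Q o.2) o.1))) +
        ∑ s ∈ range T, capacity net (U s) ≤
      ENNReal.ofReal (lyapunov net φ Q) +
        ∑ s ∈ range T, ENNReal.ofReal (∑ i ∈ U s, tr.rate i) + C := by
    have e1 : ∑ s ∈ range T, capacity net (U s) =
        mean tr.law fun o => ((∑ s ∈ range T, exits (U s) o.2 : ℕ) : ℝ≥0∞) := by
      simp only [Nat.cast_sum]
      rw [mean_sum]
      exact sum_congr rfl fun s _ => (tr.mean_exits (U s)).symm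
    have e2 : ∑ s ∈ range T, ENNReal.ofReal (∑ i ∈ U s, tr.rate i) =
        mean tr.law fun o => ((∑ s ∈ range T, ∑ i ∈ U s, o.1 i : ℕ) : ℝ≥0∞) := by
      simp only [← tr.mean_sum_arrival]
      rw [← mean_sum]
      simp only [Nat.cast_sum]
    rw [e1, e2, ← mean_add, ← mean_const tr.law (ENNReal.ofReal (lyapunov net φ Q)),
      ← mean_const tr.law (C : ℝ≥0∞), ← mean_add, ← mean_add]
    refine mean_mono _ fun o ho => ?_
    have h2 := hpol.lyapunov_drift hφ hgap hconn H Q (fun i => tr.reception_mem ho i) (ha o ho)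
    have h3 := ENNReal.ofReal_le_ofReal h2
    have hnn := lyapunov_nonneg hφ hconn Q
    rw [ENNReal.ofReal_add (lyapunov_nonneg hφ hconn _) (Nat.cast_nonneg _),
      ENNReal.ofReal_add (add_nonneg hnn (Nat.cast_nonneg _)) (Nat.cast_nonneg _),
      ENNReal.ofReal_add hnn (Nat.cast_nonneg _), ENNReal.ofReal_natCast, ENNReal.ofReal_natCast,
      ENNReal.ofReal_natCast] at h3
    exact h3
  have h2 : ∑ s ∈ range T, ENNReal.ofReal (∑ i ∈ U s, tr.rate i) +
      ∑ s ∈ range T, ENNReal.ofReal ε * ((U s).card : ℝ≥0∞) ≤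
        ∑ s ∈ range T, capacity net (U s) := by
    rw [← sum_add_distrib]
    exact sum_le_sum fun s _ => hslack (U s)
  have hfin : ∑ s ∈ range T, ENNReal.ofReal (∑ i ∈ U s, tr.rate i) ≠ ⊤ :=
    (ENNReal.sum_lt_top.2 fun s _ => ENNReal.ofReal_lt_top).ne
  have h3 : ENNReal.ofReal (ε / (φ N + 1)) * (Q i : ℝ≥0∞) ≤
      ∑ s ∈ range T, ENNReal.ofReal ε * ((U s).card : ℝ≥0∞) := by
    have e1 : (Q i : ℝ) ≤ height net φ Q i * (φ N + 1) := by
      have := backlog_le_height hφ hgap hconn Q i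
      have : (0 : ℝ) ≤ height net φ Q i := Nat.cast_nonneg _
      linarith
    -- Every level that misses `i` has `i` in its complement, which therefore contributes at least
    -- `ε` to the slack.
    have e2 : height net φ Q i ≤ ∑ s ∈ range T, (U s).card := by
      unfold height
      rw [card_filter]
      refine sum_le_sum fun s _ => ?_
      split_ifs with hi
      · exact Nat.zero_le _
      · exact card_pos.2 ⟨i, mem_compl.2 hi⟩
    have e3 : ε / (φ N + 1) * Q i ≤ ε * (∑ s ∈ range T, (U s).card : ℕ) := by
      rw [div_mul_eq_mul_div, div_le_iff₀ (by positivity), mul_assoc]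
      refine mul_le_mul_of_nonneg_left (e1.trans ?_) (le_of_lt hε)
      exact mul_le_mul_of_nonneg_right (by exact_mod_cast e2) (by positivity)
    have e4 := ENNReal.ofReal_le_ofReal e3
    rw [ENNReal.ofReal_mul hδ.le, ENNReal.ofReal_mul (le_of_lt hε), ENNReal.ofReal_natCast,
      ENNReal.ofReal_natCast, Nat.cast_sum, mul_sum] at e4
    exact e4
  -- The finite arrival term is added to both sides, so that the slack in the cuts can be used
  -- without subtraction of extended reals.
  refine (ENNReal.add_le_add_iff_right hfin).1 ?_
  calc _ ≤ mean tr.law (fun o =>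
        ENNReal.ofReal (lyapunov net φ (nextBacklog Q (pol.decide H Q o.2) o.1))) +
        ∑ s ∈ range T, capacity net (U s) := by
        rw [add_assoc]
        refine add_le_add_right (le_trans ?_ h2) _
        rw [add_comm]
        exact add_le_add_right h3 _
    _ ≤ _ := h1
    _ = _ := by ring

end Routing

theorem mainTheorem2 {N : ℕ} (net : Routing.Network N) (hconn : net.Connected) :
    -- the congestion costs are well defined, and the only solution if no queue is empty
    (∀ Q : Fin N → ℝ, (∀ i, 0 ≤ Q i) →
      ∃ V, Routing.IsCongestionCost net Q V ∧
        ((∀ i, 0 < Q i) → ∀ W, Routing.IsCostFixedPoint net Q W → W = V)) ∧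
    -- ORCD respects the path-connected `f`-policy
    (∀ f : ℕ → ℕ → ℝ, (∀ m n, 0 < n → 0 < f m n) → Routing.CondC1 f → Routing.CondRatio net f →
      (∀ Q : Fin N → ℝ, (∀ i, 0 ≤ Q i) →
        (∃! R : Routing.RankOrdering N, R.IsPathConnectedFRanking net f Q) ∧
        ∀ R R' : Routing.RankOrdering N, R.IsPathConnectedFRanking net f Q →
          Routing.IsORCDRanking net Q R' → R'.IsRefinement R) ∧
      (∀ (pol pol' : Routing.RoutingPolicy N) (R R' : Routing.RankProcess N),
        Routing.IsPathConnectedFPolicy net f pol R → Routing.IsORCDPolicy net pol' R' →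
          Routing.Respects R' R)) ∧
    -- ORCD policies exist, and they are throughput optimal
    (∃ (pol : Routing.RoutingPolicy N) (R : Routing.RankProcess N),
      Routing.IsORCDPolicy net pol R) ∧
    (∀ (pol : Routing.RoutingPolicy N) (R : Routing.RankProcess N),
      Routing.IsORCDPolicy net pol R → Routing.ThroughputOptimal net pol) := by
  refine ⟨fun Q hQ => ?_, fun f hpos hC1 hratio => ⟨fun Q hQ => ⟨?_, ?_⟩, ?_⟩,
    Routing.exists_isORCDPolicy hconn, fun pol R hpol => hpol.throughputOptimal hconn⟩
  · obtain ⟨V, hV⟩ := Routing.exists_isCongestionCost hconn hQ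
    exact ⟨V, hV, fun hQ' W hW => hW.eq_of_isCongestionCost hQ' hV⟩
  · exact Routing.RankOrdering.existsUnique_isPathConnectedFRanking hconn hpos hC1 hratio hQ
  · exact fun R R' hR hR' => hR'.isRefinement hconn hpos hC1 hratio hQ hR
  · exact fun pol pol' R R' hR hR' H Q =>
      (hR'.2 H Q).isRefinement hconn hpos hC1 hratio (fun i => Nat.cast_nonneg _) (hR.2 H Q)
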